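/- Let $d\ge 1$ and let $\Omega\subset\mathbb{R}^d$ be a bounded Lipschitz domain, i.e. a nonempty, bounded, connected open set such that for each $x\in\partial\Omega$ there are $r>0$, an isometry $T$ of $\mathbb{R}^d$ and a Lipschitz function $\varphi:\mathbb{R}^{d-1}\to\mathbb{R}$ with $T(\Omega)\cap B_r(T(x))=\{\xi=(\xi',\xi_d):\xi_d>\varphi(\xi')\}\cap B_r(T(x))$. Write $\delta_\Omega(x)=\min_{y\in\partial\Omega}|x-y|$, and for $t\in(0,1)$ put $\mathcal{L}_1(t)=\frac{1}{1-\ln t}$ and $\mathcal{L}_m(t)=\mathcal{L}_1(\mathcal{L}_{m-1}(t))$ for $m\ge 2$. For $u\in L^1(\Omega)$ let $(u)_\Omega=\frac1{|\Omega|}\int_\Omega u\,dx$ and $$[u]_{BV(\Omega)}=\sup\Big\{\int_\Omega u\,\operatorname{div}\phi\,dx:\ \phi\in C^1_c(\Omega;\mathbb{R}^d),\ |\phi|\le 1\Big\},$$ and let $BV(\Omega)$ be the set of $u\in L^1(\Omega)$ with $[u]_{BV(\Omega)}<\infty$. For $R>0$ with $\delta_\Omega(x)<R$ for all $x\in\Omega$,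 and for an integer $m\ge2$, put $$I_{m,R}(u)=\int_\Omega\frac{|u(x)-(u)_\Omega|}{\delta_\Omega(x)}\,\mathcal{L}_1\Big(\frac{\delta_\Omega(x)}{R}\Big)\cdots\mathcal{L}_{m-1}\Big(\frac{\delta_\Omega(x)}{R}\Big)\,\mathcal{L}_m^2\Big(\frac{\delta_\Omega(x)}{R}\Big)\,dx\in[0,\infty].$$ 1. There is a constant $C=C(d,\Omega)>0$ such that for all such $R$, all integers $m\ge 2$ and all $u\in BV(\Omega)$, $$I_{m,R}(u)\le C\,2^m\,[u]_{BV(\Omega)}.$$ 2. There is a constant $C=C(d,\Omega)>0$ such that for all such $R$, all $0<\alpha<\frac12$ and all $u\in BV(\Omega)$, $$\sum_{m=2}^\infty\alpha^m I_{m,R}(u)\le C\,\frac{4\alpha^2}{1-2\alpha}\,[u]_{BV(\Omega)}.$$ 3. The series inequality fails for $\alpha\ge 1$: for every such $R$ and every $\alpha\ge1$ there is no finite constant $K$ (even one depending on $d,\Omega,R,\alpha$) such that $\sum_{m=2}^\infty\alpha^m I_{m,R}(u)\le K\,[u]_{BV(\Omega)}$ for all $u\in BV(\Omega)$. -/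

import Mathlib

open MeasureTheory

noncomputable section

namespace BVHardy

/-- The point `ξ' = (ξ₁, …, ξₙ)` formed by the first `n` coordinates of `ξ ∈ ℝⁿ⁺¹`. -/
def firstCoords {n : ℕ} (ξ : EuclideanSpace ℝ (Fin (n + 1))) : EuclideanSpace ℝ (Fin n) :=
  WithLp.toLp 2 (fun i : Fin n => ξ i.castSucc)

/-- A bounded Lipschitz domain in `ℝᵈ`, `d = n + 1 ≥ 1`: a bounded, connected, nonempty open set
which near each of its boundary points lies, after an isometry of `ℝᵈ`, exactly above the graph
of a Lipschitz function of the first `d - 1` coordinates. -/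
structure IsBoundedLipschitzDomain {n : ℕ} (Ω : Set (EuclideanSpace ℝ (Fin (n + 1)))) : Prop where
  isOpen : IsOpen Ω
  isConnected : IsConnected Ω
  isBounded : Bornology.IsBounded Ω
  local_graph : ∀ x ∈ frontier Ω, ∃ r : ℝ, 0 < r ∧
    ∃ T : EuclideanSpace ℝ (Fin (n + 1)) ≃ᵢ EuclideanSpace ℝ (Fin (n + 1)),
    ∃ φ : EuclideanSpace ℝ (Fin n) → ℝ, (∃ K : NNReal, LipschitzWith K φ) ∧
      (T '' Ω) ∩ Metric.ball (T x) r =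
        {ξ | φ (firstCoords ξ) < ξ (Fin.last n)} ∩ Metric.ball (T x) r

/-- The distance `δ_Ω(x)` from `x` to the boundary of `Ω`. -/
def bdryDist {d : ℕ} (Ω : Set (EuclideanSpace ℝ (Fin d))) (x : EuclideanSpace ℝ (Fin d)) : ℝ :=
  Metric.infDist x (frontier Ω)

/-- The iterated logarithmic functions: `L₁(t) = 1 / (1 - ln t)` and `Lₘ(t) = L₁(Lₘ₋₁(t))` for
`m ≥ 2`, with the convention `L₀(t) = t`. -/
def iterL : ℕ → ℝ → ℝ
  | 0, t => t
  | m + 1, t => 1 / (1 - Real.log (iterL m t))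

/-- The divergence `∑ᵢ ∂ᵢ φᵢ` of a vector field on `ℝᵈ`. -/
def divergence {d : ℕ} (φ : EuclideanSpace ℝ (Fin d) → EuclideanSpace ℝ (Fin d))
    (x : EuclideanSpace ℝ (Fin d)) : ℝ :=
  ∑ i : Fin d, (fderiv ℝ φ x (EuclideanSpace.single i (1 : ℝ))) i

/-- The vector fields `φ ∈ C¹_c(Ω; ℝᵈ)` with `|φ| ≤ 1`, extended by zero to `ℝᵈ`. -/
def testFields {d : ℕ} (Ω : Set (EuclideanSpace ℝ (Fin d))) :
    Set (EuclideanSpace ℝ (Fin d) → EuclideanSpace ℝ (Fin d)) :=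
  {φ | ContDiff ℝ 1 φ ∧ HasCompactSupport φ ∧ tsupport φ ⊆ Ω ∧ ∀ x, ‖φ x‖ ≤ 1}

/-- The variation `[u]_{BV(Ω)} = sup {∫_Ω u div φ}` over the test fields, with values in `[0, ∞]`.
Replacing negative integrals by `0` does not change the supremum, since `φ = 0` is admissible. -/
def bvSeminorm {d : ℕ} (Ω : Set (EuclideanSpace ℝ (Fin d))) (u : EuclideanSpace ℝ (Fin d) → ℝ) :
    ENNReal :=
  ⨆ φ ∈ testFields Ω, ENNReal.ofReal (∫ x in Ω, u x * divergence φ x)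

/-- `u ∈ BV(Ω)`: `u ∈ L¹(Ω)` and `[u]_{BV(Ω)} < ∞`. -/
def MemBV {d : ℕ} (Ω : Set (EuclideanSpace ℝ (Fin d))) (u : EuclideanSpace ℝ (Fin d) → ℝ) : Prop :=
  IntegrableOn u Ω volume ∧ bvSeminorm Ω u < ⊤

/-- The integral `∫_Ω |u - (u)_Ω| / δ_Ω · L₁(δ_Ω/R) ⋯ Lₘ₋₁(δ_Ω/R) · Lₘ(δ_Ω/R)² dx`, an element of
`[0, ∞]`, where `(u)_Ω` is the average of `u` over `Ω`. -/
def hardyIntegral {d : ℕ} (Ω : Set (EuclideanSpace ℝ (Fin d))) (R : ℝ) (m : ℕ)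
    (u : EuclideanSpace ℝ (Fin d) → ℝ) : ENNReal :=
  ∫⁻ x in Ω, ENNReal.ofReal
    (|u x - ⨍ y in Ω, u y| / bdryDist Ω x
      * (∏ k ∈ Finset.Icc 1 (m - 1), iterL k (bdryDist Ω x / R))
      * iterL m (bdryDist Ω x / R) ^ 2)

/-- The series `∑_{m ≥ 2} αᵐ · hardyIntegral Ω R m u`, for `α ≥ 0`, as an element of `[0, ∞]`. -/
def hardySeries {d : ℕ} (Ω : Set (EuclideanSpace ℝ (Fin d))) (R α : ℝ)
    (u : EuclideanSpace ℝ (Fin d) → ℝ) : ENNReal :=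
  ∑' j : ℕ, ENNReal.ofReal (α ^ (j + 2)) * hardyIntegral Ω R (j + 2) u

end BVHardy

end

/-!
The weight `s⁻¹ L₁(s/R) ⋯ Lₘ₋₁(s/R) Lₘ(s/R)²` is the derivative of `s ↦ Lₘ(s/R)`, so its integral
over `(0, T)` is `Lₘ(T/R) ≤ 1`, for every `m`.

*The inequality.* No approximation of `BV` functions by smooth ones is used. If `f` is a weight on
`A` and the integrals of `f` over all segments parallel to `[0, z]` are at most `M`, then
`∫_A f(x) |u(x) - u(x + z)| dx ≤ M |z| [u]`: test the variation with the vector field `z ψ̃`, where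
`ψ̃(y)` is the average of `ψ = ± f 1_A` over `[y - z, y]`; the divergence of this field is
`ψ(y) - ψ(y - z)`, and a mollification of `ψ` respects the bound `M`
(`lintegral_mul_enorm_sub_translate_le`). Near a boundary point, a neighbourhood `A` in `Ω` sees
some ball `B ⊆ Ω`, along directions in which the height above the boundary graph increases at a
definite rate. The boundary distance `δ` is comparable to this height, and the iterated logarithms
change by a factor of order `2 ^ m` in total when their argument is replaced by a comparable one
(`hardyWeight_le_of_comparable`). Hence `M` may be taken to be a multiple of `2 ^ m`
(`IsBoundedLipschitzDomain.exists_isVisiblePair`). Integrating over all `z` from `A` to `B` bounds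
`∬ |u(x) - u(y)|` over `A × B`, with or without the weight in `x`. A triangle inequality for such
oscillation integrals, the connectedness of `Ω`, and the compactness of its closure carry the
bound to `Ω × Ω` (`IsBoundedLipschitzDomain.oscIntegral_hardyMeasure_le`), which contains both the
Poincaré inequality and the Hardy inequality. The series estimate is then a geometric series.

*The failure for `α ≥ 1`.* A bump function `u` in `Ω` has `|u - (u)_Ω| = (u)_Ω > 0` outside its
support. Along a ray up to its first exit from `Ω`, the function `δ` is nonexpansive and decreases to
`0`, so the integral of the weight over the ray is at least `Lₘ(δ(x)/R) ≥ δ(x)/R`, where `x` is the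
starting point. Hence the Hardy integrals of `u` are bounded below uniformly in `m`
(`exists_memBV_le_hardyIntegral`), and the series diverges.
-/

noncomputable section

namespace BVHardy

/-! ### Iterated logarithms and the one-dimensional weight -/

theorem iterL_pos_le_one (m : ℕ) {t : ℝ} (h0 : 0 < t) (h1 : t ≤ 1) :
    0 < iterL m t ∧ iterL m t ≤ 1 := by
  induction m with
  | zero => exact ⟨h0, h1⟩
  | succ m ih =>
    have hl := Real.log_nonpos ih.1.le ih.2
    refine ⟨by simp only [iterL]; exact div_pos one_pos (by linarith), ?_⟩
    simp only [iterL]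
    rw [div_le_one (by linarith)]; linarith

theorem iterL_mono (m : ℕ) {s t : ℝ} (h0 : 0 < s) (hst : s ≤ t) (h1 : t ≤ 1) :
    iterL m s ≤ iterL m t := by
  induction m with
  | zero => exact hst
  | succ m ih =>
    have hs := iterL_pos_le_one m h0 (hst.trans h1)
    have ht := iterL_pos_le_one m (h0.trans_le hst) h1
    have hl := Real.log_nonpos ht.1.le ht.2
    have := Real.log_le_log hs.1 ih
    simp only [iterL]
    exact one_div_le_one_div_of_le (by linarith) (by linarith)

theorem le_iterL (m : ℕ) {t : ℝ} (h0 : 0 < t) (h1 : t ≤ 1) : t ≤ iterL m t := by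
  induction m with
  | zero => exact le_rfl
  | succ m ih =>
    have ht := iterL_pos_le_one m h0 h1
    have hl := Real.log_nonpos ht.1.le ht.2
    refine ih.trans ?_
    simp only [iterL]
    have h2 := Real.one_sub_inv_le_log_of_pos ht.1
    rw [le_div_iff₀ (by linarith)]
    have h3 : iterL m t * (1 - Real.log (iterL m t)) ≤ iterL m t * (iterL m t)⁻¹ :=
      mul_le_mul_of_nonneg_left (by linarith) ht.1.le
    rwa [mul_inv_cancel₀ ht.1.ne'] at h3

/-- Dividing the argument by `c` costs a factor that decreases to `2` along the iteration, since
`1 + log a` stays below the tangent of slope `1 / 2` at `a = 2`; the product of these factors is the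
source of the constant `2 ^ m`. -/
theorem iterL_le_mul_iterL_div (m : ℕ) {c t : ℝ} (hc : 1 ≤ c) (h0 : 0 < t) (h1 : t ≤ 1) :
    iterL m t ≤ (2 + c / 2 ^ m) * iterL m (t / c) := by
  have hc0 : 0 < c := by linarith
  induction m with
  | zero =>
    simp only [iterL, pow_zero, div_one]
    rw [mul_div_assoc', le_div_iff₀ hc0]
    nlinarith
  | succ m ih =>
    have hp := iterL_pos_le_one m h0 h1
    have hq := iterL_pos_le_one m (div_pos h0 hc0) ((div_le_self h0.le hc).trans h1)
    have ha : 0 < c / 2 ^ m := by positivity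
    set a : ℝ := 2 + c / 2 ^ m with ha_def
    set p := iterL m t
    set q := iterL m (t / c)
    have hlp := Real.log_nonpos hp.1.le hp.2
    have hlq := Real.log_nonpos hq.1.le hq.2
    have hla : 0 ≤ Real.log a := Real.log_nonneg (by linarith)
    have hlog : Real.log p ≤ Real.log a + Real.log q := by
      rw [← Real.log_mul (by positivity) hq.1.ne']
      exact Real.log_le_log hp.1 ih
    have hla2 : 1 + Real.log a ≤ 2 + c / 2 ^ (m + 1) := by
      have h2 : Real.log (a / 2) ≤ a / 2 - 1 := Real.log_le_sub_one_of_pos (by positivity)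
      rw [Real.log_div (by positivity) two_ne_zero] at h2
      have h3 := Real.log_two_lt_d9
      have h4 : c / 2 ^ (m + 1) = c / 2 ^ m / 2 := by rw [pow_succ]; field_simp
      rw [h4]; linarith
    have hkey : 1 - Real.log q ≤ (2 + c / 2 ^ (m + 1)) * (1 - Real.log p) :=
      calc 1 - Real.log q ≤ (1 + Real.log a) * (1 - Real.log p) := by nlinarith
        _ ≤ _ := mul_le_mul_of_nonneg_right hla2 (by linarith)
    change 1 / (1 - Real.log p) ≤ _ * (1 / (1 - Real.log q))
    rw [mul_one_div, div_le_div_iff₀ (by linarith) (by linarith)]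
    linarith

/-- The one-dimensional weight `s⁻¹ L₁(s/R) ⋯ Lₘ₋₁(s/R) Lₘ(s/R)²`. For `m ≥ 1` it is the derivative
of `s ↦ Lₘ(s/R)`. -/
def hardyWeight (R : ℝ) (m : ℕ) (s : ℝ) : ℝ :=
  s⁻¹ * (∏ k ∈ Finset.Icc 1 (m - 1), iterL k (s / R)) * iterL m (s / R) ^ 2

theorem hardyWeight_nonneg {R s : ℝ} (m : ℕ) (hs : 0 < s) (hsR : s ≤ R) :
    0 ≤ hardyWeight R m s := by
  have hR : 0 < R := hs.trans_le hsR
  have h := fun k => (iterL_pos_le_one k (div_pos hs hR) ((div_le_one hR).2 hsR)).1.le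
  exact mul_nonneg (mul_nonneg (by positivity) (Finset.prod_nonneg fun k _ => h k)) (by positivity)

theorem hardyWeight_le_inv {R s : ℝ} (m : ℕ) (hs : 0 < s) (hsR : s ≤ R) :
    hardyWeight R m s ≤ s⁻¹ := by
  have hR : 0 < R := hs.trans_le hsR
  have h := fun k => iterL_pos_le_one k (div_pos hs hR) ((div_le_one hR).2 hsR)
  have h1 : ∏ k ∈ Finset.Icc 1 (m - 1), iterL k (s / R) ≤ 1 :=
    Finset.prod_le_one (fun k _ => (h k).1.le) fun k _ => (h k).2
  have h2 : iterL m (s / R) ^ 2 ≤ 1 := pow_le_one₀ (h m).1.le (h m).2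
  have h0 : 0 ≤ ∏ k ∈ Finset.Icc 1 (m - 1), iterL k (s / R) :=
    Finset.prod_nonneg fun k _ => (h k).1.le
  unfold hardyWeight
  calc _ ≤ s⁻¹ * 1 * 1 := by gcongr
    _ = s⁻¹ := by ring

theorem measurable_iterL (m : ℕ) : Measurable (iterL m) := by
  induction m with
  | zero => exact measurable_id
  | succ m ih =>
    change Measurable fun t => 1 / (1 - Real.log (iterL m t))
    fun_prop

theorem measurable_hardyWeight (R : ℝ) (m : ℕ) : Measurable (hardyWeight R m) := by
  have h := fun k => (measurable_iterL k).comp (measurable_id.div_const R)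
  exact (measurable_inv.mul (Finset.measurable_fun_prod _ fun k _ => h k)).mul ((h m).pow_const 2)

/-- By the chain rule, `Lₘ₊₁' = Lₘ' Lₘ₊₁² / Lₘ`, so that the product of the factors builds up. -/
theorem hasDerivAt_iterL (m : ℕ) {t : ℝ} (h0 : 0 < t) (h1 : t ≤ 1) :
    HasDerivAt (iterL (m + 1))
      (t⁻¹ * (∏ k ∈ Finset.Icc 1 m, iterL k t) * iterL (m + 1) t ^ 2) t := by
  have key : ∀ (m : ℕ) (p : ℝ), HasDerivAt (iterL m) p t →
      HasDerivAt (iterL (m + 1)) (p / iterL m t * iterL (m + 1) t ^ 2) t := by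
    intro m p hp
    have ht := iterL_pos_le_one m h0 h1
    have hl := Real.log_nonpos ht.1.le ht.2
    have h2 := ((hp.log ht.1.ne').const_sub 1).inv (by linarith)
    have h3 : iterL (m + 1) = (fun y => 1 - Real.log (iterL m y))⁻¹ := by
      ext y; simp [iterL]
    rw [h3]
    refine h2.congr_deriv ?_
    rw [neg_neg, Pi.inv_apply, inv_pow, div_eq_mul_inv]
  induction m with
  | zero =>
    refine (key 0 1 (hasDerivAt_id t)).congr_deriv ?_
    simp [iterL]
  | succ m ih =>
    refine (key (m + 1) _ ih).congr_deriv ?_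
    have ht := (iterL_pos_le_one (m + 1) h0 h1).1.ne'
    rw [Finset.prod_Icc_succ_top (by omega)]
    field_simp

theorem hasDerivAt_iterL_div {R s : ℝ} {m : ℕ} (hm : 1 ≤ m) (hs : 0 < s) (hsR : s ≤ R) :
    HasDerivAt (fun s => iterL m (s / R)) (hardyWeight R m s) s := by
  obtain ⟨m, rfl⟩ := Nat.exists_eq_add_of_le' hm
  have hR : 0 < R := hs.trans_le hsR
  have h := (hasDerivAt_iterL m (div_pos hs hR) ((div_le_one hR).2 hsR)).comp s
    ((hasDerivAt_id s).div_const R)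
  refine h.congr_deriv ?_
  simp only [hardyWeight, Nat.add_sub_cancel]
  field_simp

open Filter Topology in
theorem tendsto_iterL_zero (m : ℕ) : Tendsto (iterL m) (𝓝[>] 0) (𝓝[>] 0) := by
  induction m with
  | zero => exact tendsto_id
  | succ m ih =>
    have h1 : Tendsto (fun t => 1 - Real.log (iterL m t)) (𝓝[>] 0) atTop := by
      have := (tendsto_neg_atBot_atTop.comp (Real.tendsto_log_nhdsGT_zero.comp ih))
      simpa [sub_eq_add_neg, Function.comp_def] using tendsto_atTop_add_const_left _ 1 this
    have h2 := tendsto_inv_atTop_nhdsGT_zero.comp h1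
    refine h2.congr fun t => ?_
    simp [iterL]

open Filter Topology Set in
/-- The weight has an explicit integral, which is at most `1` whatever `m` and `R` are. -/
theorem lintegral_hardyWeight {R T : ℝ} {m : ℕ} (hm : 1 ≤ m) (hT : 0 < T) (hTR : T ≤ R) :
    ∫⁻ s in Ioo 0 T, ENNReal.ofReal (hardyWeight R m s) = ENNReal.ofReal (iterL m (T / R)) := by
  have hR : 0 < R := hT.trans_le hTR
  -- `iterL m 0` is a junk value, so the primitive is redefined at `0`
  set F : ℝ → ℝ := Function.update (fun s => iterL m (s / R)) 0 0 with hF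
  have hFd : ∀ s, 0 < s → s ≤ R → HasDerivAt F (hardyWeight R m s) s := by
    intro s hs hsR
    refine (hasDerivAt_iterL_div hm hs hsR).congr_of_eventuallyEq ?_
    filter_upwards [lt_mem_nhds hs] with y hy
    simp [hF, Function.update_of_ne hy.ne']
  have hcont : ContinuousOn F (Icc 0 T) := by
    intro s hs
    rcases hs.1.eq_or_lt with rfl | h
    · have h1 : Tendsto (fun s => iterL m (s / R)) (𝓝[>] 0) (𝓝 0) := by
        refine ((tendsto_iterL_zero m).mono_right nhdsWithin_le_nhds).comp ?_
        refine tendsto_nhdsWithin_iff.2 ⟨?_, ?_⟩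
        · have : Tendsto (fun s : ℝ => s / R) (𝓝 0) (𝓝 (0 / R)) := tendsto_id.div_const R
          rw [zero_div] at this
          exact this.mono_left nhdsWithin_le_nhds
        · filter_upwards [self_mem_nhdsWithin] with s hs
          exact div_pos hs hR
      have h3 : ContinuousWithinAt F (Ici 0) 0 := by
        rw [← Ioi_insert, continuousWithinAt_insert_self]
        have : F 0 = 0 := by simp [hF]
        rw [ContinuousWithinAt, this]
        refine h1.congr' ?_
        filter_upwards [self_mem_nhdsWithin] with s hs
        simp [hF, Function.update_of_ne (ne_of_gt (mem_Ioi.1 hs))]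
      exact h3.mono Icc_subset_Ici_self
    · exact (hFd s h (hs.2.trans hTR)).continuousAt.continuousWithinAt
  have hint : IntegrableOn (hardyWeight R m) (Ioc 0 T) :=
    intervalIntegral.integrableOn_deriv_of_nonneg hcont
      (fun s hs => hFd s hs.1 (hs.2.le.trans hTR))
      (fun s hs => hardyWeight_nonneg m hs.1 (hs.2.le.trans hTR))
  have hftc := intervalIntegral.integral_eq_sub_of_hasDerivAt_of_le hT.le hcont
      (fun s hs => hFd s hs.1 (hs.2.le.trans hTR))
      ((intervalIntegrable_iff_integrableOn_Ioc_of_le hT.le).2 hint)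
  rw [restrict_Ioo_eq_restrict_Ioc, ← ofReal_integral_eq_lintegral_ofReal hint, 
    ← intervalIntegral.integral_of_le hT.le, hftc]
  · simp [hF, Function.update_of_ne hT.ne']
  · filter_upwards [ae_restrict_mem measurableSet_Ioc] with s hs
    exact hardyWeight_nonneg m hs.1 (hs.2.trans hTR)

theorem prod_two_add_div_two_pow_le {c : ℝ} (hc : 0 ≤ c) (m : ℕ) :
    ∏ k ∈ Finset.Icc 1 m, (2 + c / 2 ^ k) ≤ 2 ^ m * Real.exp c := by
  have h : ∀ m : ℕ, ∏ k ∈ Finset.Icc 1 m, (2 + c / 2 ^ k) ≤ 2 ^ m * Real.exp (c - c / 2 ^ m) := by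
    intro m
    induction m with
    | zero => simp
    | succ m ih =>
      rw [Finset.prod_Icc_succ_top (by omega)]
      have h1 : 2 + c / 2 ^ (m + 1) ≤ 2 * Real.exp (c / 2 ^ (m + 1)) := by
        have := Real.add_one_le_exp (c / 2 ^ (m + 1))
        have : 0 ≤ c / 2 ^ (m + 1) := by positivity
        linarith
      calc _ ≤ (2 ^ m * Real.exp (c - c / 2 ^ m)) * (2 * Real.exp (c / 2 ^ (m + 1))) := by
            gcongr
        _ = 2 ^ (m + 1) * (Real.exp (c - c / 2 ^ m) * Real.exp (c / 2 ^ (m + 1))) := by ring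
        _ = _ := by
          rw [← Real.exp_add]
          congr 2
          field_simp
          ring
  refine (h m).trans ?_
  have : 0 ≤ c / 2 ^ m := by positivity
  gcongr
  linarith

/-- Replacing the argument `s` of the weight by a comparable `t` costs at most a multiple
of `2 ^ m`, provided that `R` is enlarged so that `t` stays below it. -/
theorem hardyWeight_le_of_comparable {R c s t : ℝ} {m : ℕ} (hc : 1 ≤ c)
    (hs : 0 < s) (hsR : s ≤ R) (hst : s ≤ t) (htc : t ≤ c * s) :
    hardyWeight R m s
      ≤ c * (Real.exp c * (2 + c) ^ 2) * 2 ^ m * hardyWeight (c * R) m t := by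
  have hR : 0 < R := hs.trans_le hsR
  have hc0 : 0 < c := by linarith
  have ht : 0 < t := hs.trans_le hst
  have hs1 : s / R ≤ 1 := (div_le_one hR).2 hsR
  have ht1 : t / (c * R) ≤ 1 := by
    rw [div_le_one (by positivity)]; exact htc.trans (by gcongr)
  have hL : ∀ k, iterL k (s / R) ≤ (2 + c / 2 ^ k) * iterL k (t / (c * R)) := by
    intro k
    refine (iterL_le_mul_iterL_div k hc (div_pos hs hR) hs1).trans ?_
    have : s / R / c ≤ t / (c * R) := by
      rw [div_div, mul_comm R c]; gcongr
    have := iterL_mono k (by positivity) this ht1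
    gcongr
  have hp : ∀ k, 0 < iterL k (s / R) := fun k => (iterL_pos_le_one k (div_pos hs hR) hs1).1
  have hq : ∀ k, 0 < iterL k (t / (c * R)) :=
    fun k => (iterL_pos_le_one k (by positivity) ht1).1
  have h1 : s⁻¹ ≤ c * t⁻¹ := by
    rw [← div_eq_mul_inv, le_div_iff₀ ht, inv_mul_le_iff₀ hs]
    linarith
  have h2 : ∏ k ∈ Finset.Icc 1 (m - 1), iterL k (s / R)
      ≤ (2 ^ m * Real.exp c) * ∏ k ∈ Finset.Icc 1 (m - 1), iterL k (t / (c * R)) := by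
    refine (Finset.prod_le_prod (fun k _ => (hp k).le) fun k _ => hL k).trans ?_
    rw [Finset.prod_mul_distrib]
    refine mul_le_mul_of_nonneg_right ?_ (Finset.prod_nonneg fun k _ => (hq k).le)
    refine (prod_two_add_div_two_pow_le hc0.le _).trans ?_
    gcongr
    · norm_num
    · omega
  have h3 : iterL m (s / R) ^ 2 ≤ (2 + c) ^ 2 * iterL m (t / (c * R)) ^ 2 := by
    rw [← mul_pow]
    have h4 : c / 2 ^ m ≤ c := div_le_self hc0.le (one_le_pow₀ one_le_two)
    have h5 := hq m
    exact pow_le_pow_left₀ (hp m).le ((hL m).trans (by gcongr)) 2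
  have h6 : 0 ≤ ∏ k ∈ Finset.Icc 1 (m - 1), iterL k (s / R) :=
    Finset.prod_nonneg fun k _ => (hp k).le
  have h7 : 0 ≤ ∏ k ∈ Finset.Icc 1 (m - 1), iterL k (t / (c * R)) :=
    Finset.prod_nonneg fun k _ => (hq k).le
  unfold hardyWeight
  calc _ ≤ (c * t⁻¹) * ((2 ^ m * Real.exp c) * ∏ k ∈ Finset.Icc 1 (m - 1), iterL k (t / (c * R)))
        * ((2 + c) ^ 2 * iterL m (t / (c * R)) ^ 2) := by gcongr
    _ = _ := by ring

open Set Metric Filter Topology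

/-! ### Translation estimates from the dual definition of the variation -/

section translation

variable {d : ℕ} {Ω : Set (EuclideanSpace ℝ (Fin d))} {u : EuclideanSpace ℝ (Fin d) → ℝ}

theorem divergence_const_smul {φ : EuclideanSpace ℝ (Fin d) → EuclideanSpace ℝ (Fin d)}
    (c : ℝ) (x : EuclideanSpace ℝ (Fin d)) (hφ : DifferentiableAt ℝ φ x) :
    divergence (fun y => c • φ y) x = c * divergence φ x := by
  simp only [divergence, fderiv_fun_const_smul hφ, Finset.mul_sum]
  rfl

theorem divergence_smul_const {g : EuclideanSpace ℝ (Fin d) → ℝ} (z x : EuclideanSpace ℝ (Fin d))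
    (hg : DifferentiableAt ℝ g x) :
    divergence (fun y => g y • z) x = fderiv ℝ g x z := by
  have hz : z = ∑ i, z i • EuclideanSpace.single i (1 : ℝ) := by
    ext j
    simp [Finset.sum_apply, Pi.single_apply]
  have h : fderiv ℝ (fun y => g y • z) x = (fderiv ℝ g x).smulRight z :=
    (hg.hasFDerivAt.smul_const z).fderiv
  simp only [divergence, h]
  conv_rhs => rw [hz, map_sum]
  refine Finset.sum_congr rfl fun i _ => ?_
  simp [mul_comm]

/-- The bound that defines the variation, for test fields of length at most `M`. -/
theorem ofReal_integral_mul_divergence_le {φ : EuclideanSpace ℝ (Fin d) → EuclideanSpace ℝ (Fin d)}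
    {M : ℝ} (hM : 0 < M) (hφ : ContDiff ℝ 1 φ) (hc : HasCompactSupport φ) (hs : tsupport φ ⊆ Ω)
    (hb : ∀ x, ‖φ x‖ ≤ M) :
    ENNReal.ofReal (∫ x in Ω, u x * divergence φ x) ≤ ENNReal.ofReal M * bvSeminorm Ω u := by
  set θ : EuclideanSpace ℝ (Fin d) → EuclideanSpace ℝ (Fin d) := fun y => M⁻¹ • φ y with hθ
  have hsub : tsupport θ ⊆ tsupport φ := closure_mono (Function.support_const_smul_subset M⁻¹ φ)
  have hmem : θ ∈ testFields Ω := by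
    refine ⟨hφ.const_smul _, hc.mono' ((subset_tsupport θ).trans hsub), hsub.trans hs, fun x => ?_⟩
    rw [hθ, norm_smul, norm_inv, Real.norm_of_nonneg hM.le, inv_mul_le_iff₀ hM, mul_one]
    exact hb x
  have h1 : ∫ x in Ω, u x * divergence φ x = M * ∫ x in Ω, u x * divergence θ x := by
    rw [← integral_const_mul]
    congr 1 with x
    rw [hθ, divergence_const_smul _ _ (hφ.differentiable one_ne_zero x)]
    field_simp
  rw [h1, ENNReal.ofReal_mul hM.le]
  gcongr
  exact le_iSup₂ (f := fun φ _ => ENNReal.ofReal (∫ x in Ω, u x * divergence φ x)) θ hmem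

/-- The derivative in direction `z` of the average of `g` over the segments `[y - z, y]`. -/
theorem fderiv_integral_segment {g G : EuclideanSpace ℝ (Fin d) → ℝ} {y z : EuclideanSpace ℝ (Fin d)}
    (hg : Continuous g) (hG : DifferentiableAt ℝ G y)
    (h : ∀ x, G x = ∫ s in (0 : ℝ)..1, g (x - s • z)) :
    fderiv ℝ G y z = g y - g (y - z) := by
  set k : ℝ → ℝ := fun σ => g (y + σ • z) with hk_def
  have hk : Continuous k := by fun_prop
  have h1 : ∀ τ : ℝ, G (y + τ • z) = (∫ σ in (0 : ℝ)..τ, k σ) - ∫ σ in (0 : ℝ)..(τ - 1), k σ := by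
    intro τ
    rw [h, intervalIntegral.integral_interval_sub_left (hk.intervalIntegrable _ _)
      (hk.intervalIntegrable _ _)]
    have := intervalIntegral.integral_comp_sub_left k τ (a := 0) (b := 1)
    rw [sub_zero] at this
    rw [← this]
    refine intervalIntegral.integral_congr fun s _ => ?_
    simp only [hk_def, sub_smul]
    congr 1
    abel
  have h2 : HasDerivAt (fun τ : ℝ => G (y + τ • z)) (k 0 - k (0 - 1)) 0 := by
    simp_rw [h1]
    have ha : ∀ x : ℝ, HasDerivAt (fun τ => ∫ σ in (0 : ℝ)..τ, k σ) (k x) x :=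
      fun x => (hk.integral_hasStrictDerivAt 0 x).hasDerivAt
    have hb := (ha (0 - 1)).comp (0 : ℝ) ((hasDerivAt_id (0 : ℝ)).sub_const 1)
    rw [mul_one] at hb
    exact (ha 0).sub hb
  have h3 : HasDerivAt (fun τ : ℝ => G (y + τ • z)) (fderiv ℝ G y z) 0 := by
    have hl : HasDerivAt (fun τ : ℝ => y + τ • z) z 0 := by
      simpa using ((hasDerivAt_id (0 : ℝ)).smul_const z).const_add y
    have hG' : HasFDerivAt G (fderiv ℝ G y) (y + (0 : ℝ) • z) := by simpa using hG.hasFDerivAt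
    exact hG'.comp_hasDerivAt (0 : ℝ) hl
  rw [h3.unique h2]
  simp [hk_def, sub_eq_add_neg]

/-- The mollification of `g` by the normalized bump function `η`. -/
abbrev mollify (η : ContDiffBump (0 : EuclideanSpace ℝ (Fin d)))
    (g : EuclideanSpace ℝ (Fin d) → ℝ) : EuclideanSpace ℝ (Fin d) → ℝ :=
  convolution (η.normed volume) g (ContinuousLinearMap.lsmul ℝ ℝ) volume

theorem locallyIntegrable_of_bounded {K : Set (EuclideanSpace ℝ (Fin d))}
    {ψ : EuclideanSpace ℝ (Fin d) → ℝ} {N : ℝ} (hK : IsCompact K) (hψ : Measurable ψ)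
    (hN : ∀ x, |ψ x| ≤ N) (hψK : ∀ x, x ∉ K → ψ x = 0) : LocallyIntegrable ψ volume := by
  have h : IntegrableOn ψ K volume :=
    Measure.integrableOn_of_bounded hK.measure_lt_top.ne hψ.aestronglyMeasurable
      (M := N) (Eventually.of_forall hN)
  refine ((integrableOn_iff_integrable_of_support_subset fun x hx => ?_).1 h).locallyIntegrable
  by_contra hx'
  exact hx (hψK x hx')

theorem integrable_normed_mul_comp {ψ : EuclideanSpace ℝ (Fin d) → ℝ} {N : ℝ}
    (η : ContDiffBump (0 : EuclideanSpace ℝ (Fin d))) (hψ : Measurable ψ) (hN : ∀ x, |ψ x| ≤ N)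
    (y z : EuclideanSpace ℝ (Fin d)) :
    Integrable (fun p : EuclideanSpace ℝ (Fin d) × ℝ =>
      η.normed volume p.1 * ψ (y - p.1 - p.2 • z)) (volume.prod (volume.restrict (Ioc 0 1))) := by
  have h1 : Integrable (fun p : EuclideanSpace ℝ (Fin d) × ℝ => η.normed volume p.1 * N)
      (volume.prod (volume.restrict (Ioc 0 1))) :=
    (η.integrable_normed (μ := volume)).mul_prod (integrable_const N)
  refine h1.mono' ?_ (Eventually.of_forall fun p => ?_)
  · have h2 : Measurable fun p : EuclideanSpace ℝ (Fin d) × ℝ => y - p.1 - p.2 • z := by fun_prop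
    exact ((η.continuous_normed.measurable.comp measurable_fst).mul
      (hψ.comp h2)).aestronglyMeasurable
  · rw [norm_mul, Real.norm_of_nonneg (η.nonneg_normed _)]
    exact mul_le_mul_of_nonneg_left (hN _) (η.nonneg_normed _)

/-- Mollification commutes with averaging over segments. -/
theorem mollify_integral_segment {ψ : EuclideanSpace ℝ (Fin d) → ℝ} {N : ℝ}
    (η : ContDiffBump (0 : EuclideanSpace ℝ (Fin d))) (hψ : Measurable ψ) (hN : ∀ x, |ψ x| ≤ N)
    (y z : EuclideanSpace ℝ (Fin d)) :
    mollify η (fun x => ∫ s in (0 : ℝ)..1, ψ (x - s • z)) y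
      = ∫ s in (0 : ℝ)..1, mollify η ψ (y - s • z) := by
  simp only [convolution_def, ContinuousLinearMap.lsmul_apply, smul_eq_mul,
    intervalIntegral.integral_of_le zero_le_one, ← integral_const_mul]
  rw [integral_integral_swap]
  · refine integral_congr_ae (Eventually.of_forall fun s => ?_)
    simp only
    congr 1 with t
    rw [sub_right_comm]
  · exact integrable_normed_mul_comp η hψ hN y z

theorem abs_mollify_le {g : EuclideanSpace ℝ (Fin d) → ℝ} {M : ℝ}
    (η : ContDiffBump (0 : EuclideanSpace ℝ (Fin d))) (hM : ∀ x, |g x| ≤ M)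
    (y : EuclideanSpace ℝ (Fin d)) :
    |mollify η g y| ≤ M := by
  simp only [convolution_def, ContinuousLinearMap.lsmul_apply, smul_eq_mul]
  have h1 : Integrable (fun t => η.normed volume t * M) volume := η.integrable_normed.mul_const M
  calc _ ≤ ∫ t, η.normed volume t * M := by
        rw [← Real.norm_eq_abs]
        refine norm_integral_le_of_norm_le h1 (Eventually.of_forall fun t => ?_)
        rw [norm_mul, Real.norm_of_nonneg (η.nonneg_normed _)]
        exact mul_le_mul_of_nonneg_left (hM _) (η.nonneg_normed _)
    _ = M := by rw [integral_mul_const, η.integral_normed, one_mul]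

/-- The bound on `∫ u(y) (ψ(y) - ψ(y - z)) dy` for a mollified `ψ`. The test field is `z` times the
average of this mollification over segments in direction `z`: mollifying preserves the bound on
these averages. -/
theorem ofReal_integral_mollified_le {K : Set (EuclideanSpace ℝ (Fin d))}
    {z : EuclideanSpace ℝ (Fin d)} {ψ : EuclideanSpace ℝ (Fin d) → ℝ} {M N ε : ℝ}
    (hK : IsCompact K) (hψ : Measurable ψ) (hN : ∀ x, |ψ x| ≤ N) (hψK : ∀ x, x ∉ K → ψ x = 0)
    (hM0 : 0 < M) (hz : z ≠ 0)
    (hM : ∀ y, |∫ s in (0 : ℝ)..1, ψ (y - s • z)| ≤ M)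
    (hε : cthickening ε ((fun p : EuclideanSpace ℝ (Fin d) × ℝ => p.1 + p.2 • z) ''
      (K ×ˢ Icc 0 1)) ⊆ Ω)
    (η : ContDiffBump (0 : EuclideanSpace ℝ (Fin d))) (hη : η.rOut ≤ ε) :
    ENNReal.ofReal (∫ y in Ω, u y *
        (mollify η ψ y
          - mollify η ψ (y - z)))
      ≤ ENNReal.ofReal (M * ‖z‖) * bvSeminorm Ω u := by
  set K' := (fun p : EuclideanSpace ℝ (Fin d) × ℝ => p.1 + p.2 • z) '' (K ×ˢ Icc 0 1) with hK'_def
  have hK' : IsCompact K' := (hK.prod isCompact_Icc).image (by fun_prop)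
  set Ψ : EuclideanSpace ℝ (Fin d) → ℝ := fun y => ∫ s in (0 : ℝ)..1, ψ (y - s • z) with hΨ
  set g := mollify η ψ with hg_def
  set G := mollify η Ψ with hG_def
  have hψint : LocallyIntegrable ψ volume :=
    locallyIntegrable_of_bounded hK hψ hN hψK
  have hΨK : ∀ x, x ∉ K' → Ψ x = 0 := by
    intro x hx
    rw [hΨ]
    refine intervalIntegral.integral_zero_ae (Eventually.of_forall fun s hs => hψK _ fun h => hx ?_)
    rw [uIoc_of_le zero_le_one] at hs
    exact ⟨(x - s • z, s), ⟨h, hs.1.le, hs.2⟩, by simp⟩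
  have hΨm : Measurable Ψ := by
    have h2 : Measurable fun p : EuclideanSpace ℝ (Fin d) × ℝ => ψ (p.1 - p.2 • z) :=
      hψ.comp (by fun_prop)
    have := h2.stronglyMeasurable.integral_prod_right' (ν := volume.restrict (Ioc (0 : ℝ) 1))
    simp only [hΨ, intervalIntegral.integral_of_le zero_le_one]
    exact this.measurable
  have hΨint : LocallyIntegrable Ψ volume := locallyIntegrable_of_bounded hK' hΨm hM hΨK
  have hg : ContDiff ℝ 1 g :=
    η.hasCompactSupport_normed.contDiff_convolution_left _ η.contDiff_normed hψint
  have hG : ContDiff ℝ 1 G :=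
    η.hasCompactSupport_normed.contDiff_convolution_left _ η.contDiff_normed hΨint
  have hsupp : tsupport G ⊆ cthickening ε K' := by
    refine closure_minimal (fun x hx => ?_) isClosed_cthickening
    obtain ⟨a, ha, b, hb, rfl⟩ := support_convolution_subset _ hx
    rw [η.support_normed_eq] at ha
    have hb' : b ∈ K' := by by_contra h; exact hb (hΨK b h)
    refine mem_cthickening_of_dist_le _ b _ _ hb' ?_
    rw [dist_eq_norm, add_sub_cancel_right]
    exact (mem_ball_zero_iff.1 ha).le.trans hη
  have hGc : HasCompactSupport G :=
    hK'.cthickening.of_isClosed_subset (isClosed_tsupport G) hsupp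
  have hsub : tsupport (fun y => G y • z) ⊆ tsupport G :=
    closure_mono (Function.support_smul_subset_left G fun _ => z)
  have key := ofReal_integral_mul_divergence_le (u := u) (Ω := Ω) (φ := fun y => G y • z)
    (M := M * ‖z‖) (mul_pos hM0 (norm_pos_iff.2 hz)) (hG.smul contDiff_const)
    (hGc.mono' ((subset_tsupport _).trans hsub)) (hsub.trans (hsupp.trans hε)) fun x => by
      rw [norm_smul]
      exact mul_le_mul_of_nonneg_right (abs_mollify_le η hM x) (norm_nonneg z)
  refine le_of_eq_of_le ?_ key
  congr 2 with y
  rw [divergence_smul_const _ _ (hG.differentiable one_ne_zero y),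
    fderiv_integral_segment hg.continuous (hG.differentiable one_ne_zero y)
      fun x => mollify_integral_segment η hψ hN x z]

/-- The estimate of `ofReal_integral_mollified_le` for a merely bounded measurable `ψ`, by dominated
convergence. -/
theorem ofReal_integral_mul_sub_le {K : Set (EuclideanSpace ℝ (Fin d))}
    {z : EuclideanSpace ℝ (Fin d)} {ψ : EuclideanSpace ℝ (Fin d) → ℝ} {M N : ℝ}
    (hΩ : IsOpen Ω) (hu : IntegrableOn u Ω volume)
    (hK : IsCompact K) (hψ : Measurable ψ) (hN : ∀ x, |ψ x| ≤ N) (hψK : ∀ x, x ∉ K → ψ x = 0)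
    (hM0 : 0 < M) (hz : z ≠ 0)
    (hM : ∀ y, |∫ s in (0 : ℝ)..1, ψ (y - s • z)| ≤ M)
    (hKΩ : ∀ x ∈ K, ∀ s ∈ Icc (0 : ℝ) 1, x + s • z ∈ Ω) :
    ENNReal.ofReal (∫ y in Ω, u y * (ψ y - ψ (y - z)))
      ≤ ENNReal.ofReal (M * ‖z‖) * bvSeminorm Ω u := by
  set K' := (fun p : EuclideanSpace ℝ (Fin d) × ℝ => p.1 + p.2 • z) '' (K ×ˢ Icc 0 1) with hK'_def
  have hK' : IsCompact K' := (hK.prod isCompact_Icc).image (by fun_prop)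
  have hK'Ω : K' ⊆ Ω := by
    rintro _ ⟨⟨x, s⟩, ⟨hx, hs⟩, rfl⟩
    exact hKΩ x hx s hs
  obtain ⟨ε, hε, hεΩ⟩ := hK'.exists_cthickening_subset_open hΩ hK'Ω
  have hψint : LocallyIntegrable ψ volume :=
    locallyIntegrable_of_bounded hK hψ hN hψK
  -- the ratio of the radii stays bounded, so that the mollifications converge almost everywhere
  let η : ℕ → ContDiffBump (0 : EuclideanSpace ℝ (Fin d)) := fun k =>
    { rIn := ε / (k + 1) / 2
      rOut := ε / (k + 1)
      rIn_pos := by positivity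
      rIn_lt_rOut := half_lt_self (by positivity) }
  have hηout : ∀ k, (η k).rOut = ε / (k + 1) := fun k => rfl
  have hη0 : Tendsto (fun k => (η k).rOut) atTop (𝓝 0) := by
    simp_rw [hηout, div_eq_mul_one_div ε]
    simpa using (tendsto_one_div_add_atTop_nhds_zero_nat (𝕜 := ℝ)).const_mul ε
  have hae := ContDiffBump.ae_convolution_tendsto_right_of_locallyIntegrable (K := 2) hη0
    (Eventually.of_forall fun k => by
      change ε / (k + 1) ≤ 2 * (ε / (k + 1) / 2); linarith) hψint
  have hae' := (measurePreserving_sub_right volume z).quasiMeasurePreserving.ae hae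
  have hlim : Tendsto (fun k => ∫ y in Ω, u y *
        (mollify (η k) ψ y
          - mollify (η k) ψ (y - z)))
      atTop (𝓝 (∫ y in Ω, u y * (ψ y - ψ (y - z)))) := by
    refine tendsto_integral_of_dominated_convergence (fun y => ‖u y‖ * (N + N)) ?_
      (hu.norm.mul_const _) ?_ ?_
    · intro k
      have hc : Continuous (mollify (η k) ψ) :=
        ((η k).hasCompactSupport_normed.contDiff_convolution_left (n := 1) _
          (η k).contDiff_normed hψint).continuous
      exact hu.aestronglyMeasurable.mul (by fun_prop)
    · intro k
      refine Eventually.of_forall fun y => ?_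
      rw [norm_mul]
      gcongr
      exact (norm_sub_le _ _).trans (add_le_add (abs_mollify_le (η k) hN _)
        (abs_mollify_le (η k) hN _))
    · filter_upwards [ae_restrict_of_ae hae, ae_restrict_of_ae hae'] with y h1 h2
      exact (h1.sub h2).const_mul _
  refine le_of_tendsto ((ENNReal.continuous_ofReal.tendsto _).comp hlim)
    (Eventually.of_forall fun k => ?_)
  refine ofReal_integral_mollified_le hK hψ hN hψK hM0 hz hM hεΩ (η k) ?_
  rw [hηout]
  exact div_le_self hε.le (by linarith [k.cast_nonneg (α := ℝ)])

/-- A translation moves the increment from `ψ` to `u`. -/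
theorem integral_mul_sub_translate {E : Set (EuclideanSpace ℝ (Fin d))}
    {z : EuclideanSpace ℝ (Fin d)} {ψ : EuclideanSpace ℝ (Fin d) → ℝ} {N : ℝ}
    (hΩ : MeasurableSet Ω) (hu : IntegrableOn u Ω volume) (hE : MeasurableSet E)
    (hψ : Measurable ψ) (hN : ∀ x, |ψ x| ≤ N) (hψE : ∀ x, x ∉ E → ψ x = 0)
    (hEΩ : E ⊆ Ω) (hEzΩ : ∀ x ∈ E, x + z ∈ Ω) :
    IntegrableOn (fun x => ψ x * (u x - u (x + z))) E volume ∧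
    ∫ y in Ω, u y * (ψ y - ψ (y - z)) = ∫ x in E, ψ x * (u x - u (x + z)) := by
  have hi1 : IntegrableOn (fun y => u y * ψ y) Ω volume :=
    hu.mul_bdd (c := N) hψ.aestronglyMeasurable (Eventually.of_forall hN)
  have hi2 : IntegrableOn (fun y => u y * ψ (y - z)) Ω volume :=
    hu.mul_bdd (c := N) (hψ.comp (measurable_sub_const z)).aestronglyMeasurable
      (Eventually.of_forall fun x => hN _)
  have hmp : MeasurePreserving (fun x => x + z) (volume : Measure (EuclideanSpace ℝ (Fin d))) volume :=
    measurePreserving_add_right volume z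
  have hemb : MeasurableEmbedding (fun x : EuclideanSpace ℝ (Fin d) => x + z) :=
    (Homeomorph.addRight z).measurableEmbedding
  have h1 : ∫ y in Ω, u y * ψ y = ∫ x in E, u x * ψ x :=
    setIntegral_eq_of_subset_of_forall_sdiff_eq_zero hΩ hEΩ fun x hx => by simp [hψE x hx.2]
  have hE' : MeasurableSet ((fun x => x - z) ⁻¹' E) := (measurable_sub_const z) hE
  have hpre : (fun x => x + z) ⁻¹' ((fun x => x - z) ⁻¹' E) = E := by
    ext x; simp
  have hE'Ω : (fun x => x - z) ⁻¹' E ⊆ Ω := fun y hy => by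
    simpa using hEzΩ _ hy
  have h2 : ∫ y in Ω, u y * ψ (y - z) = ∫ x in E, u (x + z) * ψ x := by
    rw [setIntegral_eq_of_subset_of_forall_sdiff_eq_zero hΩ hE'Ω fun x hx => by simp [hψE _ hx.2],
      ← hmp.setIntegral_preimage_emb hemb, hpre]
    simp
  have hi2' : IntegrableOn (fun x => u (x + z) * ψ x) E volume := by
    have := (hmp.integrableOn_comp_preimage hemb).2 (hi2.mono_set hE'Ω)
    rw [hpre] at this
    simpa [Function.comp_def] using this
  have hi1' := hi1.mono_set hEΩ
  have heq : (fun x => ψ x * (u x - u (x + z))) = fun x => u x * ψ x - u (x + z) * ψ x := by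
    ext x; ring
  rw [heq]
  refine ⟨hi1'.sub hi2', ?_⟩
  rw [integral_sub hi1' hi2', ← h1, ← h2, ← integral_sub hi1 hi2]
  congr 1 with y
  ring

/-- The weighted translation estimate: the variation controls the increments of `u` in direction
`z`, with any weight that has bounded integrals over the segments in this direction. -/
theorem lintegral_mul_enorm_sub_translate_le {A : Set (EuclideanSpace ℝ (Fin d))}
    {f : EuclideanSpace ℝ (Fin d) → ℝ} {z : EuclideanSpace ℝ (Fin d)} {M : ℝ}
    (hΩ : IsOpen Ω) (hu : IntegrableOn u Ω volume) (hum : Measurable u)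
    (hA : IsOpen A) (hAb : Bornology.IsBounded A)
    (hAΩ : ∀ x ∈ A, ∀ s ∈ Icc (0 : ℝ) 1, x + s • z ∈ Ω)
    (hf : Measurable f) (hf0 : ∀ x ∈ A, 0 ≤ f x) (hM0 : 0 < M)
    (hM : ∀ y, ∫⁻ s in Ioc (0 : ℝ) 1, A.indicator (fun x => ENNReal.ofReal (f x)) (y - s • z)
      ≤ ENNReal.ofReal M) :
    ∫⁻ x in A, ENNReal.ofReal (f x) * ‖u x - u (x + z)‖ₑ
      ≤ ENNReal.ofReal (M * ‖z‖) * bvSeminorm Ω u := by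
  rcases eq_or_ne z 0 with rfl | hz
  · simp
  -- exhaust `A` by sets that lie in compact subsets of `A` and on which `f` is bounded
  obtain ⟨F, hFc, hFA, hFU, hFm⟩ := hA.exists_iUnion_isClosed
  set E : ℕ → Set (EuclideanSpace ℝ (Fin d)) := fun k => F k ∩ {x | f x ≤ k} with hE_def
  have hEm : ∀ k, MeasurableSet (E k) := fun k =>
    (hFc k).measurableSet.inter (measurableSet_le hf measurable_const)
  have hEmono : Monotone E := fun i j hij x hx =>
    ⟨hFm hij hx.1, le_trans (show f x ≤ i from hx.2) (by exact_mod_cast hij)⟩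
  have hEU : A = ⋃ k, E k := by
    refine subset_antisymm (fun x hx => ?_) (iUnion_subset fun k x hx => hFA k hx.1)
    rw [← hFU, mem_iUnion] at hx
    obtain ⟨i, hi⟩ := hx
    obtain ⟨j, hj⟩ := exists_nat_ge (f x)
    exact mem_iUnion.2 ⟨max i j, hFm (le_max_left _ _) hi,
      hj.trans (by exact_mod_cast le_max_right _ _)⟩
  conv_lhs => rw [hEU]
  rw [setLIntegral_iUnion_of_directed _ hEmono.directed_le]
  refine iSup_le fun k => ?_
  have hEA : E k ⊆ A := fun x hx => hFA k hx.1
  have hduz : Measurable fun x => u x - u (x + z) := hum.sub (hum.comp (measurable_add_const z))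
  -- the signed weight that turns the increments into their absolute values
  set ψ : EuclideanSpace ℝ (Fin d) → ℝ :=
    (E k).indicator fun x => if 0 ≤ u x - u (x + z) then f x else -f x with hψ_def
  have hψm : Measurable ψ :=
    (Measurable.ite (measurableSet_le measurable_const hduz) hf hf.neg).indicator (hEm k)
  have habs : ∀ x, |ψ x| = (E k).indicator f x := by
    intro x
    by_cases hx : x ∈ E k
    · have := hf0 x (hEA hx)
      simp only [hψ_def, indicator_of_mem hx]
      split_ifs
      · exact abs_of_nonneg this
      · rw [abs_neg, abs_of_nonneg this]
    · simp [hψ_def, indicator_of_notMem hx]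
  have hψN : ∀ x, |ψ x| ≤ k := by
    intro x
    rw [habs]
    by_cases hx : x ∈ E k
    · rw [indicator_of_mem hx]; exact hx.2
    · rw [indicator_of_notMem hx]; positivity
  have hψE : ∀ x, x ∉ E k → ψ x = 0 := fun x hx => indicator_of_notMem hx _
  have hψM : ∀ y, |∫ s in (0 : ℝ)..1, ψ (y - s • z)| ≤ M := by
    intro y
    rw [← ENNReal.ofReal_le_ofReal_iff hM0.le, ← Real.enorm_eq_ofReal_abs,
      intervalIntegral.integral_of_le zero_le_one]
    refine (enorm_integral_le_lintegral_enorm _).trans ((lintegral_mono fun s => ?_).trans (hM y))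
    rw [Real.enorm_eq_ofReal_abs, habs]
    by_cases hx : y - s • z ∈ E k
    · rw [indicator_of_mem hx, indicator_of_mem (hEA hx)]
    · rw [indicator_of_notMem hx]; simp
  have hEΩ : E k ⊆ Ω := fun x hx => by simpa using hAΩ x (hEA hx) 0 (by simp)
  obtain ⟨hint, heq⟩ := integral_mul_sub_translate (z := z) hΩ.measurableSet hu (hEm k)
    hψm hψN hψE hEΩ fun x hx => by simpa using hAΩ x (hEA hx) 1 (by simp)
  have hFk : IsCompact (F k) :=
    isCompact_of_isClosed_isBounded (hFc k) (hAb.subset (hFA k))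
  have key := ofReal_integral_mul_sub_le hΩ hu hFk hψm hψN
    (fun x hx => hψE x fun h => hx h.1) hM0 hz hψM fun x hx => hAΩ x (hFA k hx)
  rw [heq, ofReal_integral_eq_lintegral_ofReal hint] at key
  · refine le_trans (le_of_eq ?_) key
    refine setLIntegral_congr_fun (hEm k) fun x hx => ?_
    have hfx := hf0 x (hEA hx)
    simp only [hψ_def, indicator_of_mem hx, Real.enorm_eq_ofReal_abs]
    rw [← ENNReal.ofReal_mul hfx]
    split_ifs with h
    · rw [abs_of_nonneg h]
    · rw [abs_of_neg (not_le.1 h)]; ring_nf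
  · filter_upwards [ae_restrict_mem (hEm k)] with x hx
    have hfx := hf0 x (hEA hx)
    simp only [hψ_def, indicator_of_mem hx, Pi.zero_apply]
    split_ifs with h
    · exact mul_nonneg hfx h
    · exact mul_nonneg_of_nonpos_of_nonpos (by linarith) (not_le.1 h).le

/-- Integrating the translation estimate over all translations that carry a point of `A` to
a point of `B`. -/
theorem lintegral_lintegral_mul_enorm_sub_le {A B : Set (EuclideanSpace ℝ (Fin d))}
    {f : EuclideanSpace ℝ (Fin d) → ℝ} {M D : ℝ}
    (hΩ : IsOpen Ω) (hu : IntegrableOn u Ω volume) (hum : Measurable u)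
    (hA : IsOpen A) (hAb : Bornology.IsBounded A) (hB : IsOpen B)
    (hAB : ∀ x ∈ A, ∀ y ∈ B, segment ℝ x y ⊆ Ω)
    (hD : ∀ x ∈ A, ∀ y ∈ B, ‖y - x‖ ≤ D)
    (hf : Measurable f) (hf0 : ∀ x ∈ A, 0 ≤ f x) (hM0 : 0 < M)
    (hM : ∀ x ∈ A, ∀ y ∈ B, ∀ p, ∫⁻ s in Ioc (0 : ℝ) 1,
      A.indicator (fun x => ENNReal.ofReal (f x)) (p - s • (y - x)) ≤ ENNReal.ofReal M) :
    ∫⁻ x in A, ∫⁻ y in B, ENNReal.ofReal (f x) * ‖u x - u y‖ₑ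
      ≤ ENNReal.ofReal (M * D) * volume (closedBall (0 : EuclideanSpace ℝ (Fin d)) D)
        * bvSeminorm Ω u := by
  -- substitute `y = x + z`, then integrate over `x` first
  have h1 : ∀ x, ∫⁻ y in B, ENNReal.ofReal (f x) * ‖u x - u y‖ₑ
      = ∫⁻ z, B.indicator (fun y => ENNReal.ofReal (f x) * ‖u x - u y‖ₑ) (x + z) := by
    intro x
    rw [← lintegral_indicator hB.measurableSet, lintegral_add_left_eq_self]
  simp_rw [h1]
  have hmeas : Measurable fun p : EuclideanSpace ℝ (Fin d) × EuclideanSpace ℝ (Fin d) =>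
      B.indicator (fun y => ENNReal.ofReal (f p.1) * ‖u p.1 - u y‖ₑ) (p.1 + p.2) := by
    have h2 : (fun p : EuclideanSpace ℝ (Fin d) × EuclideanSpace ℝ (Fin d) =>
        B.indicator (fun y => ENNReal.ofReal (f p.1) * ‖u p.1 - u y‖ₑ) (p.1 + p.2))
        = ((fun p => p.1 + p.2) ⁻¹' B).indicator
          (fun p => ENNReal.ofReal (f p.1) * ‖u p.1 - u (p.1 + p.2)‖ₑ) := by
      ext p; rfl
    rw [h2]
    refine Measurable.indicator ?_ ((measurable_fst.add measurable_snd) hB.measurableSet)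
    fun_prop
  rw [lintegral_lintegral_swap hmeas.aemeasurable]
  have h3 : ∀ z, ∫⁻ x in A, B.indicator (fun y => ENNReal.ofReal (f x) * ‖u x - u y‖ₑ) (x + z)
      ≤ (closedBall (0 : EuclideanSpace ℝ (Fin d)) D).indicator
        (fun _ => ENNReal.ofReal (M * D) * bvSeminorm Ω u) z := by
    intro z
    set A' := A ∩ (fun x => x + z) ⁻¹' B with hA'_def
    have hA' : IsOpen A' := hA.inter (hB.preimage (by fun_prop))
    have h4 : ∫⁻ x in A, B.indicator (fun y => ENNReal.ofReal (f x) * ‖u x - u y‖ₑ) (x + z)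
        = ∫⁻ x in A', ENNReal.ofReal (f x) * ‖u x - u (x + z)‖ₑ := by
      rw [hA'_def, inter_comm, ← Measure.restrict_restrict (hB.preimage (by fun_prop)).measurableSet,
        ← lintegral_indicator (hB.preimage (by fun_prop)).measurableSet]
      rfl
    rw [h4]
    rcases A'.eq_empty_or_nonempty with he | ⟨x₀, hx₀, hx₀z⟩
    · simp [he]
    have hzD : ‖z‖ ≤ D := by simpa using hD x₀ hx₀ _ hx₀z
    rw [indicator_of_mem (by simpa using hzD)]
    refine (lintegral_mul_enorm_sub_translate_le hΩ hu hum hA' (hAb.subset inter_subset_left) ?_ hf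
      (fun x hx => hf0 x hx.1) hM0 fun p => ?_).trans ?_
    · intro x hx s hs
      refine hAB x hx.1 _ hx.2 ?_
      rw [segment_eq_image']
      exact ⟨s, hs, by simp⟩
    · refine (lintegral_mono fun s => ?_).trans (by simpa using hM x₀ hx₀ _ hx₀z p)
      exact indicator_le_indicator_of_subset inter_subset_left (fun _ => zero_le) _
    · gcongr
  refine (lintegral_mono h3).trans (le_of_eq ?_)
  rw [lintegral_indicator isClosed_closedBall.measurableSet, setLIntegral_const]
  ring

end translation

/-! ### Weights along lines -/

/-- A function that expands distances by a factor `c` compresses Lebesgue measure at most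
by `1 / c`. -/
theorem lintegral_comp_le_of_expanding {g : ℝ → ℝ} {c : ℝ} (hc : 0 < c) (hg : Measurable g)
    (h : ∀ s t, c * |s - t| ≤ |g s - g t|) {W : ℝ → ENNReal} (hW : Measurable W) :
    ∫⁻ s, W (g s) ≤ ENNReal.ofReal c⁻¹ * ∫⁻ t, W t := by
  have hanti : AntilipschitzWith (Real.toNNReal c⁻¹) g := by
    refine AntilipschitzWith.of_le_mul_dist fun s t => ?_
    rw [Real.coe_toNNReal _ (by positivity), inv_mul_eq_div, le_div_iff₀ hc, Real.dist_eq,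
      Real.dist_eq, mul_comm]
    exact h s t
  have hle : Measure.map g volume ≤ ENNReal.ofReal c⁻¹ • (volume : Measure ℝ) := by
    refine Measure.le_iff.2 fun S hS => ?_
    rw [Measure.map_apply hg hS, ← hausdorffMeasure_real, Measure.smul_apply, smul_eq_mul]
    simpa [ENNReal.ofReal] using hanti.hausdorffMeasure_preimage_le zero_le_one S
  rw [← lintegral_map hW hg]
  refine (lintegral_mono' hle le_rfl).trans (le_of_eq ?_)
  rw [lintegral_smul_measure, smul_eq_mul]

/-- A nonexpansive function that takes the values `T` and `0` at the ends of an interval does not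
compress Lebesgue measure on `(0, T)`. -/
theorem lintegral_Ioo_le_of_nonexpansive {q : ℝ → ℝ} {a b T : ℝ} (hab : a ≤ b)
    (hq : LipschitzWith 1 q) (ha : q a = T) (hb : q b = 0) {W : ℝ → ENNReal} (hW : Measurable W) :
    ∫⁻ t in Ioo 0 T, W t ≤ ∫⁻ s in Ioo a b, W (q s) := by
  have hle : volume.restrict (Ioo 0 T) ≤ Measure.map q (volume.restrict (Ioo a b)) := by
    refine Measure.le_iff.2 fun S hS => ?_
    have hqS := hq.continuous.measurable hS
    rw [Measure.map_apply hq.continuous.measurable hS, Measure.restrict_apply hS,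
      Measure.restrict_apply hqS, ← hausdorffMeasure_real]
    have hsub : S ∩ Ioo 0 T ⊆ q '' (q ⁻¹' S ∩ Ioo a b) := by
      rintro t ⟨htS, ht⟩
      obtain ⟨s, hs, rfl⟩ := intermediate_value_Ioo' hab hq.continuous.continuousOn
        (show t ∈ Ioo (q b) (q a) by rw [ha, hb]; exact ht)
      exact ⟨s, ⟨htS, hs⟩, rfl⟩
    refine (measure_mono hsub).trans ?_
    simpa using hq.hausdorffMeasure_image_le zero_le_one (q ⁻¹' S ∩ Ioo a b)
  rw [← lintegral_map hW hq.continuous.measurable]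
  exact lintegral_mono' hle le_rfl

/-! ### Geometry of the domain near its boundary -/

section bdryDist

variable {d : ℕ} {Ω : Set (EuclideanSpace ℝ (Fin d))}

theorem lipschitzWith_bdryDist : LipschitzWith 1 (bdryDist Ω) := lipschitz_infDist_pt _

theorem measurable_bdryDist : Measurable (bdryDist Ω) :=
  lipschitzWith_bdryDist.continuous.measurable

theorem bdryDist_le_dist {x y : EuclideanSpace ℝ (Fin d)} (hx : x ∈ Ω) (hy : y ∉ Ω) :
    bdryDist Ω x ≤ dist x y := by
  have hconn : IsPreconnected (segment ℝ x y) := (convex_segment x y).isPreconnected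
  obtain ⟨w, hw, hwΩ⟩ : (segment ℝ x y ∩ frontier Ω).Nonempty := by
    by_contra! hemp
    have hnot : ∀ w ∈ segment ℝ x y, w ∉ frontier Ω := fun w hw h =>
      notMem_empty w (hemp ▸ ⟨hw, h⟩)
    have hcases : ∀ w ∈ segment ℝ x y, w ∈ interior Ω ∨ w ∈ (closure Ω)ᶜ := by
      intro w hw
      by_contra! h
      exact hnot w hw ⟨not_not.1 h.2, h.1⟩
    have hxi := (hcases x (left_mem_segment ℝ x y)).resolve_right fun h => h (subset_closure hx)
    have hyi := (hcases y (right_mem_segment ℝ x y)).resolve_left fun h => hy (interior_subset h)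
    obtain ⟨w, _, hw1, hw2⟩ := hconn _ _ isOpen_interior isClosed_closure.isOpen_compl hcases
      ⟨x, left_mem_segment ℝ x y, hxi⟩ ⟨y, right_mem_segment ℝ x y, hyi⟩
    exact hw2 (subset_closure (interior_subset hw1))
  refine (infDist_le_dist_of_mem hwΩ).trans ?_
  have := dist_add_dist_of_mem_segment hw
  linarith [dist_nonneg (x := w) (y := y)]

end bdryDist

variable {n : ℕ} {Ω : Set (EuclideanSpace ℝ (Fin (n + 1)))}

theorem frontier_nonempty_of_isBounded (hne : Ω.Nonempty) (hb : Bornology.IsBounded Ω) :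
    (frontier Ω).Nonempty := by
  rw [nonempty_frontier_iff]
  refine ⟨hne, fun h => ?_⟩
  exact NormedSpace.unbounded_univ ℝ (EuclideanSpace ℝ (Fin (n + 1))) (h ▸ hb)

theorem bdryDist_pos (hΩ : IsOpen Ω) (hb : Bornology.IsBounded Ω)
    {x : EuclideanSpace ℝ (Fin (n + 1))} (hx : x ∈ Ω) : 0 < bdryDist Ω x := by
  refine (isClosed_frontier.notMem_iff_infDist_pos
    (frontier_nonempty_of_isBounded ⟨x, hx⟩ hb)).1 fun h => ?_
  rw [hΩ.frontier_eq] at h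
  exact h.2 hx

theorem dist_firstCoords_le (ξ ζ : EuclideanSpace ℝ (Fin (n + 1))) :
    dist (firstCoords ξ) (firstCoords ζ) ≤ dist ξ ζ := by
  rw [EuclideanSpace.dist_eq, EuclideanSpace.dist_eq, Fin.sum_univ_castSucc]
  exact Real.sqrt_le_sqrt (le_add_of_nonneg_right (sq_nonneg _))

/-- The height above the boundary graph: near a boundary point, `Ω` is the set of points of positive
height, where the height is a Lipschitz function with slope one in some unit direction `e`. -/
theorem IsBoundedLipschitzDomain.exists_height (hΩ : IsBoundedLipschitzDomain Ω)
    {x₀ : EuclideanSpace ℝ (Fin (n + 1))} (hx₀ : x₀ ∈ frontier Ω) :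
    ∃ r : ℝ, 0 < r ∧ ∃ t : EuclideanSpace ℝ (Fin (n + 1)) → ℝ, ∃ Λ : ℝ, 1 ≤ Λ ∧
      ∃ e : EuclideanSpace ℝ (Fin (n + 1)), ‖e‖ = 1 ∧ t x₀ = 0 ∧
      (∀ x y, |t x - t y| ≤ Λ * ‖x - y‖) ∧ (∀ x (s : ℝ), t (x + s • e) = t x + s) ∧
      ∀ x ∈ ball x₀ r, x ∈ Ω ↔ 0 < t x := by
  obtain ⟨r, hr, T, φ, ⟨K, hφ⟩, hT⟩ := hΩ.local_graph x₀ hx₀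
  set t : EuclideanSpace ℝ (Fin (n + 1)) → ℝ := fun x => T x (Fin.last n) - φ (firstCoords (T x))
    with ht
  set e : EuclideanSpace ℝ (Fin (n + 1)) := T.toRealAffineIsometryEquiv.linearIsometryEquiv.symm
    (EuclideanSpace.single (Fin.last n) 1) with he
  have hTe : ∀ x (s : ℝ), T (x + s • e) = T x + s • EuclideanSpace.single (Fin.last n) (1 : ℝ) := by
    intro x s
    have := T.toRealAffineIsometryEquiv.map_vadd x (s • e)
    simp only [vadd_eq_add, map_smul, he, LinearIsometryEquiv.apply_symm_apply] at this
    rw [add_comm x, add_comm (T x)]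
    exact this
  have hmem : ∀ x ∈ ball x₀ r, x ∈ Ω ↔ 0 < t x := by
    intro x hx
    have hTx : T x ∈ ball (T x₀) r := by rwa [mem_ball, T.isometry.dist_eq]
    have := Set.ext_iff.1 hT (T x)
    simp only [mem_inter_iff, hTx, and_true, T.injective.mem_set_image] at this
    rw [this, ht]
    simp [sub_pos]
  have hlip : ∀ x y, |t x - t y| ≤ (1 + K) * ‖x - y‖ := by
    intro x y
    have h1 : |T x (Fin.last n) - T y (Fin.last n)| ≤ ‖x - y‖ := by
      have := PiLp.norm_apply_le (T x - T y) (Fin.last n)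
      rw [← dist_eq_norm (T x), T.isometry.dist_eq, dist_eq_norm] at this
      simpa using this
    have h2 : |φ (firstCoords (T x)) - φ (firstCoords (T y))| ≤ K * ‖x - y‖ := by
      rw [← Real.dist_eq, ← dist_eq_norm]
      refine (hφ.dist_le_mul _ _).trans ?_
      gcongr
      rw [← T.isometry.dist_eq x y]
      exact dist_firstCoords_le _ _
    calc |t x - t y| = |(T x (Fin.last n) - T y (Fin.last n))
          - (φ (firstCoords (T x)) - φ (firstCoords (T y)))| := by rw [ht]; ring_nf
      _ ≤ _ := (abs_sub _ _).trans (by linarith)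
  refine ⟨r, hr, t, 1 + K, by simp, e, by simp [he], ?_, hlip, ?_, hmem⟩
  · refine le_antisymm ?_ ?_
    · rw [hΩ.isOpen.frontier_eq] at hx₀
      exact not_lt.1 fun h => hx₀.2 ((hmem x₀ (mem_ball_self hr)).2 h)
    · by_contra! hneg
      have hcont : Continuous t := by
        refine (LipschitzWith.of_dist_le_mul (K := 1 + K) fun x y => ?_).continuous
        rw [Real.dist_eq, dist_eq_norm]
        exact hlip x y
      have hnhds : {x | t x < 0} ∩ ball x₀ r ∈ 𝓝 x₀ :=
        inter_mem (hcont.continuousAt.eventually_lt continuousAt_const hneg) (ball_mem_nhds x₀ hr)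
      obtain ⟨y, hy, hyΩ⟩ := mem_closure_iff_nhds.1 (frontier_subset_closure hx₀) _ hnhds
      have := (hmem y hy.2).1 hyΩ
      exact lt_asymm this hy.1
  · intro x s
    have hfc : firstCoords (T x + s • EuclideanSpace.single (Fin.last n) (1 : ℝ))
        = firstCoords (T x) := by
      ext i
      simp [firstCoords]
    simp only [ht, hTe, hfc]
    simp
    ring

/-- `A` and `B` are mutually visible inside `Ω`, and the weights of the boundary distance, cut off
outside `A`, have integrals at most `C * 2 ^ m` over the segments parallel to one from `A`
to `B`. The constant `C` is required to work for all admissible `R` and all `m ≥ 1`. -/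
structure IsVisiblePair (Ω A B : Set (EuclideanSpace ℝ (Fin (n + 1)))) (C : ℝ) : Prop where
  segment_subset : ∀ x ∈ A, ∀ y ∈ B, segment ℝ x y ⊆ Ω
  lintegral_le : ∀ R : ℝ, 0 < R → (∀ x ∈ Ω, bdryDist Ω x < R) → ∀ m : ℕ, 1 ≤ m →
    ∀ x ∈ A, ∀ y ∈ B, ∀ p, ∫⁻ s in Ioc (0 : ℝ) 1,
      A.indicator (fun x => ENNReal.ofReal (hardyWeight R m (bdryDist Ω x))) (p - s • (y - x))
        ≤ ENNReal.ofReal (C * 2 ^ m)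

/-- Near an interior point the weights are bounded, because they are at most the reciprocal of the
boundary distance. -/
theorem exists_isVisiblePair_of_mem (hΩ : IsOpen Ω) (hb : Bornology.IsBounded Ω)
    {x₀ : EuclideanSpace ℝ (Fin (n + 1))} (hx₀ : x₀ ∈ Ω) :
    ∃ ρ : ℝ, 0 < ρ ∧ ball x₀ ρ ⊆ Ω ∧ ∃ C : ℝ, 0 < C ∧
      IsVisiblePair Ω (Ω ∩ ball x₀ ρ) (ball x₀ ρ) C := by
  obtain ⟨r, hr, hrΩ⟩ := Metric.isOpen_iff.1 hΩ x₀ hx₀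
  have hδ : ∀ x ∈ ball x₀ (r / 2), r / 2 ≤ bdryDist Ω x := by
    intro x hx
    refine (le_infDist (frontier_nonempty_of_isBounded ⟨x₀, hx₀⟩ hb)).2 fun y hy => ?_
    rw [hΩ.frontier_eq] at hy
    have h1 : r ≤ dist y x₀ := not_lt.1 fun h => hy.2 (hrΩ h)
    have h2 := dist_triangle_left y x₀ x
    have h3 := mem_ball.1 hx
    linarith
  have hsub : ball x₀ (r / 2) ⊆ Ω := (ball_subset_ball (by linarith)).trans hrΩ
  refine ⟨r / 2, by positivity, hsub, (r / 2)⁻¹, by positivity, ⟨?_, ?_⟩⟩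
  · intro x hx y hy
    exact ((convex_ball x₀ (r / 2)).segment_subset hx.2 hy).trans hsub
  · intro R hR hRΩ m hm x _ y _ p
    calc _ ≤ ∫⁻ s in Ioc (0 : ℝ) 1, ENNReal.ofReal ((r / 2)⁻¹ * 2 ^ m) := by
          refine lintegral_mono fun s => indicator_apply_le' (fun h => ?_) fun _ => zero_le
          refine ENNReal.ofReal_le_ofReal ?_
          refine (hardyWeight_le_inv m (bdryDist_pos hΩ hb h.1) (hRΩ _ h.1).le).trans ?_
          calc _ ≤ (r / 2)⁻¹ := inv_anti₀ (by positivity) (hδ _ h.2)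
            _ ≤ (r / 2)⁻¹ * 2 ^ m :=
              le_mul_of_one_le_right (by positivity) (one_le_pow₀ one_le_two)
      _ = _ := by simp

/-- Near a boundary point `x₀`, the ball is centred at `x₀ + h • e`, straight above `x₀`. Along the
directions from `A` to `B` the height is expanding, so the integrals of the weights reduce to
one-dimensional integrals over the height. -/
theorem IsBoundedLipschitzDomain.exists_isVisiblePair_of_mem_frontier
    (hΩ : IsBoundedLipschitzDomain Ω) {x₀ : EuclideanSpace ℝ (Fin (n + 1))}
    (hx₀ : x₀ ∈ frontier Ω) :
    ∃ ρ : ℝ, 0 < ρ ∧ ∃ b, ball b ρ ⊆ Ω ∧ ∃ C : ℝ, 0 < C ∧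
      IsVisiblePair Ω (Ω ∩ ball x₀ ρ) (ball b ρ) C := by
  obtain ⟨r, hr, t, Λ, hΛ, e, he, ht0, hlip, hte, hmem⟩ := hΩ.exists_height hx₀
  have hΛ0 : 0 < Λ := by linarith
  -- `ρ` is so small compared with `h` that all directions from `A` to `B` are close to `e`
  set h : ℝ := r / 4 with hh
  have hh0 : 0 < h := by positivity
  set ρ : ℝ := h / (4 * Λ) with hρ
  have hρ0 : 0 < ρ := by positivity
  have hρΛ : Λ * ρ = h / 4 := by rw [hρ]; field_simp
  have hρh : ρ ≤ h / 4 := by rw [← hρΛ]; nlinarith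
  set b := x₀ + h • e with hb_def
  have hbx₀ : dist b x₀ = h := by
    rw [dist_eq_norm, hb_def, add_sub_cancel_left, norm_smul, he, mul_one, Real.norm_of_nonneg hh0.le]
  -- the height increases at rate `h / 2` along directions close to `h • e`
  have hcone : ∀ z : EuclideanSpace ℝ (Fin (n + 1)), ‖z - h • e‖ ≤ 2 * ρ → ∀ x (s : ℝ), 0 ≤ s →
      t x + h / 2 * s ≤ t (x + s • z) := by
    intro z hz x s hs
    have h1 := (abs_le.1 (hlip (x + s • z) (x + (s * h) • e))).1
    have h2 : x + s • z - (x + (s * h) • e) = s • (z - h • e) := by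
      rw [smul_sub, smul_smul]; abel
    rw [h2, hte, norm_smul, Real.norm_of_nonneg hs] at h1
    have h3 : Λ * (s * ‖z - h • e‖) ≤ h / 2 * s := by
      calc Λ * (s * ‖z - h • e‖) ≤ Λ * (s * (2 * ρ)) := by gcongr
        _ = h / 2 * s := by linear_combination 2 * s * hρΛ
    linarith
  have hdir : ∀ x ∈ ball x₀ ρ, ∀ y ∈ ball b ρ, ‖y - x - h • e‖ ≤ 2 * ρ := by
    intro x hx y hy
    rw [mem_ball, dist_eq_norm] at hx hy
    have : y - x - h • e = (y - b) - (x - x₀) := by rw [hb_def]; abel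
    rw [this]
    exact (norm_sub_le _ _).trans (by linarith)
  have hballr : ∀ s : ℝ, s ≤ h + ρ → ball x₀ s ⊆ ball x₀ r :=
    fun s hs => ball_subset_ball (by linarith)
  have hbr : ball b ρ ⊆ ball x₀ (h + ρ) := by
    refine ball_subset_ball' ?_
    rw [hbx₀, add_comm]
  have hbΩ : ball b ρ ⊆ Ω := by
    intro y hy
    refine (hmem y (hballr _ le_rfl (hbr hy))).2 ?_
    have h1 := (abs_le.1 (hlip y b)).1
    have h2 : t b = h := by rw [hb_def, hte, ht0, zero_add]
    rw [mem_ball, dist_eq_norm] at hy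
    have h3 : Λ * ‖y - b‖ ≤ h / 4 := by rw [← hρΛ]; gcongr
    linarith
  -- the height and the distance to the boundary are comparable near `x₀`
  have hδ : ∀ x ∈ Ω ∩ ball x₀ ρ, 0 < t x ∧ bdryDist Ω x ≤ t x ∧ t x ≤ Λ * bdryDist Ω x := by
    rintro x ⟨hxΩ, hx⟩
    have hpos : 0 < t x := (hmem x (hballr ρ (by linarith) hx)).1 hxΩ
    have hxx₀ : ‖x - x₀‖ < ρ := by rwa [mem_ball, dist_eq_norm] at hx
    have htx : t x ≤ Λ * ‖x - x₀‖ := by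
      have := (abs_le.1 (hlip x x₀)).2
      linarith
    refine ⟨hpos, ?_, ?_⟩
    · set y := x + (-t x) • e with hy_def
      have hxy : dist x y = t x := by
        rw [dist_eq_norm, hy_def, sub_add_cancel_left, neg_smul, neg_neg, norm_smul, he, mul_one,
          Real.norm_of_nonneg hpos.le]
      have hyr : y ∈ ball x₀ r := by
        rw [mem_ball]
        have h1 := dist_triangle y x x₀
        rw [dist_comm y x, hxy] at h1
        have h2 : Λ * ‖x - x₀‖ ≤ h / 4 := by rw [← hρΛ]; gcongr
        have h3 := mem_ball.1 hx
        linarith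
      have hyΩ : y ∉ Ω := fun hy => by
        have := (hmem y hyr).1 hy
        rw [hy_def, hte] at this
        linarith
      exact hxy ▸ bdryDist_le_dist hxΩ hyΩ
    · rw [← div_le_iff₀' hΛ0]
      refine (le_infDist ⟨x₀, hx₀⟩).2 fun y hy => ?_
      rw [div_le_iff₀' hΛ0]
      by_cases hyr : y ∈ ball x₀ r
      · rw [hΩ.isOpen.frontier_eq] at hy
        have h1 : t y ≤ 0 := not_lt.1 fun h => hy.2 ((hmem y hyr).2 h)
        have h2 := (abs_le.1 (hlip x y)).2
        rw [dist_eq_norm]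
        linarith
      · refine htx.trans (mul_le_mul_of_nonneg_left ?_ hΛ0.le)
        have h1 : r ≤ dist y x₀ := not_lt.1 hyr
        have h2 := dist_triangle_left y x₀ x
        rw [dist_eq_norm x x₀] at h2
        linarith
  refine ⟨ρ, hρ0, b, hbΩ, 2 / h * (Λ * (Real.exp Λ * (2 + Λ) ^ 2)), by positivity, ⟨?_, ?_⟩⟩
  · intro x hx y hy w hw
    have hwr : w ∈ ball x₀ r :=
      hballr _ le_rfl ((convex_ball x₀ (h + ρ)).segment_subset
        (ball_subset_ball (by linarith) hx.2) (hbr hy) hw)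
    rw [segment_eq_image'] at hw
    obtain ⟨s, hs, rfl⟩ := hw
    refine (hmem _ hwr).2 ?_
    have h1 := hcone (y - x) (hdir x hx.2 y hy) x s hs.1
    have h2 : 0 ≤ h / 2 * s := mul_nonneg (by positivity) hs.1
    simp only
    linarith [(hδ x hx).1]
  · intro R hR hRΩ m hm x hx y hy p
    set z := y - x with hz
    set C₀ : ℝ := Λ * (Real.exp Λ * (2 + Λ) ^ 2) with hC₀
    have hC₀0 : 0 < C₀ := by positivity
    set g : ℝ → ℝ := fun s => t (p - s • z) with hg_def
    have htc : Continuous t := by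
      refine (LipschitzWith.of_dist_le_mul (K := ⟨Λ, hΛ0.le⟩) fun x y => ?_).continuous
      rw [Real.dist_eq, dist_eq_norm]
      exact hlip x y
    have hgc : Continuous g := by fun_prop
    have hgmono : ∀ s s', s ≤ s' → h / 2 * (s' - s) ≤ g s - g s' := by
      intro s s' hss
      have h1 := hcone z (hdir x hx.2 y hy) (p - s' • z) (s' - s) (by linarith)
      have h2 : p - s' • z + (s' - s) • z = p - s • z := by rw [sub_smul]; abel
      rw [h2] at h1
      simp only [hg_def]
      linarith
    have hgexp : ∀ s s', h / 2 * |s - s'| ≤ |g s - g s'| := by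
      intro s s'
      rcases le_total s s' with hss | hss
      · rw [abs_sub_comm, abs_of_nonneg (sub_nonneg.2 hss)]
        exact (hgmono s s' hss).trans (le_abs_self _)
      · rw [abs_of_nonneg (sub_nonneg.2 hss), abs_sub_comm]
        exact (hgmono s' s hss).trans (le_abs_self _)
    -- the weight as a function of the height, with `R` enlarged to `Λ * R`
    set W : ℝ → ENNReal := (Ioo 0 (Λ * R)).indicator
      fun τ => ENNReal.ofReal (C₀ * 2 ^ m) * ENNReal.ofReal (hardyWeight (Λ * R) m τ) with hW_def
    have hWm : Measurable W :=
      ((measurable_hardyWeight (Λ * R) m).ennreal_ofReal.const_mul _).indicator measurableSet_Ioo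
    have hpt : ∀ s, (Ω ∩ ball x₀ ρ).indicator
        (fun x => ENNReal.ofReal (hardyWeight R m (bdryDist Ω x))) (p - s • z) ≤ W (g s) := by
      intro s
      refine indicator_apply_le' (fun hs => ?_) fun _ => zero_le
      obtain ⟨h1, h2, h3⟩ := hδ _ hs
      have hδ0 := bdryDist_pos hΩ.isOpen hΩ.isBounded hs.1
      have hδR := hRΩ _ hs.1
      have hmemI : g s ∈ Ioo 0 (Λ * R) := ⟨h1, h3.trans_lt (by gcongr)⟩
      rw [hW_def, indicator_of_mem hmemI, ← ENNReal.ofReal_mul (by positivity)]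
      exact ENNReal.ofReal_le_ofReal (hardyWeight_le_of_comparable hΛ hδ0 hδR.le h2 h3)
    calc _ ≤ ∫⁻ s in Ioc (0 : ℝ) 1, W (g s) := lintegral_mono hpt
      _ ≤ ∫⁻ s, W (g s) := setLIntegral_le_lintegral _ _
      _ ≤ ENNReal.ofReal (h / 2)⁻¹ * ∫⁻ τ, W τ :=
        lintegral_comp_le_of_expanding (by positivity) hgc.measurable hgexp hWm
      _ = ENNReal.ofReal (h / 2)⁻¹ * (ENNReal.ofReal (C₀ * 2 ^ m)
            * ENNReal.ofReal (iterL m (Λ * R / (Λ * R)))) := by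
        rw [hW_def, lintegral_indicator measurableSet_Ioo, lintegral_const_mul _
          (measurable_hardyWeight (Λ * R) m).ennreal_ofReal,
          lintegral_hardyWeight hm (by positivity) le_rfl]
      _ ≤ ENNReal.ofReal (h / 2)⁻¹ * (ENNReal.ofReal (C₀ * 2 ^ m) * 1) := by
        gcongr
        rw [div_self (by positivity), ← ENNReal.ofReal_one]
        exact ENNReal.ofReal_le_ofReal (iterL_pos_le_one m one_pos le_rfl).2
      _ = _ := by
        rw [mul_one, ← ENNReal.ofReal_mul (by positivity), inv_div, ← mul_assoc]

/-- Each point of the closure has a neighbourhood that is visible from some ball in `Ω`. -/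
theorem IsBoundedLipschitzDomain.exists_isVisiblePair (hΩ : IsBoundedLipschitzDomain Ω)
    {x₀ : EuclideanSpace ℝ (Fin (n + 1))} (hx₀ : x₀ ∈ closure Ω) :
    ∃ ρ : ℝ, 0 < ρ ∧ ∃ b, ball b ρ ⊆ Ω ∧ ∃ C : ℝ, 0 < C ∧
      IsVisiblePair Ω (Ω ∩ ball x₀ ρ) (ball b ρ) C := by
  by_cases h : x₀ ∈ Ω
  · obtain ⟨ρ, hρ, hb, hC⟩ := exists_isVisiblePair_of_mem hΩ.isOpen hΩ.isBounded h
    exact ⟨ρ, hρ, x₀, hb, hC⟩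
  · exact hΩ.exists_isVisiblePair_of_mem_frontier (by rw [hΩ.isOpen.frontier_eq]; exact ⟨hx₀, h⟩)

/-! ### Mean oscillations between measures -/

section oscIntegral

variable {α : Type*} [MeasurableSpace α] {u : α → ℝ} {μ ν κ : Measure α}

/-- The mean oscillation `∬ |u(x) - u(y)| dμ(x) dν(y)`. -/
def oscIntegral (u : α → ℝ) (μ ν : Measure α) : ENNReal :=
  ∫⁻ x, ∫⁻ y, ‖u x - u y‖ₑ ∂ν ∂μ

theorem measurable_lintegral_enorm_sub [SFinite ν] (hu : Measurable u) :
    Measurable fun x => ∫⁻ y, ‖u x - u y‖ₑ ∂ν := by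
  refine Measurable.lintegral_prod_right' (f := fun p : α × α => ‖u p.1 - u p.2‖ₑ) ?_
  fun_prop

theorem oscIntegral_comm [SFinite μ] [SFinite ν] (hu : Measurable u) :
    oscIntegral u μ ν = oscIntegral u ν μ := by
  unfold oscIntegral
  rw [lintegral_lintegral_swap (by fun_prop)]
  simp_rw [enorm_sub_rev]

theorem oscIntegral_mono {μ' ν' : Measure α} (hμ : μ ≤ μ') (hν : ν ≤ ν') :
    oscIntegral u μ ν ≤ oscIntegral u μ' ν' :=
  lintegral_mono' hμ fun _ => lintegral_mono' hν le_rfl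

/-- The triangle inequality `|u(x) - u(z)| ≤ |u(x) - u(y)| + |u(y) - u(z)|`, averaged over `y`. -/
theorem oscIntegral_trans [SFinite μ] [SFinite ν] [SFinite κ] (hu : Measurable u)
    (h0 : ν univ ≠ 0) (htop : ν univ ≠ ⊤) :
    oscIntegral u μ κ
      ≤ (ν univ)⁻¹ * (κ univ * oscIntegral u μ ν + μ univ * oscIntegral u ν κ) := by
  rw [mul_comm, ← div_eq_mul_inv, ENNReal.le_div_iff_mul_le (Or.inl h0) (Or.inl htop)]
  have hk : ∀ x z, ‖u x - u z‖ₑ * ν univ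
      ≤ ∫⁻ y, ‖u x - u y‖ₑ ∂ν + ∫⁻ y, ‖u z - u y‖ₑ ∂ν := by
    intro x z
    rw [← lintegral_const, ← lintegral_add_left (by fun_prop)]
    refine lintegral_mono fun y => ?_
    rw [enorm_sub_rev (u z)]
    exact (congrArg _ (sub_add_sub_cancel _ _ _).symm).trans_le (enorm_add_le _ _)
  have hm := measurable_lintegral_enorm_sub (ν := ν) hu
  calc oscIntegral u μ κ * ν univ
      = ∫⁻ x, ∫⁻ z, ‖u x - u z‖ₑ * ν univ ∂κ ∂μ := by
        rw [oscIntegral, ← lintegral_mul_const _ (measurable_lintegral_enorm_sub hu)]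
        congr 1 with x
        rw [lintegral_mul_const _ (by fun_prop)]
    _ ≤ ∫⁻ x, ∫⁻ z, (∫⁻ y, ‖u x - u y‖ₑ ∂ν + ∫⁻ y, ‖u z - u y‖ₑ ∂ν) ∂κ ∂μ :=
        lintegral_mono fun x => lintegral_mono fun z => hk x z
    _ = κ univ * oscIntegral u μ ν + μ univ * oscIntegral u ν κ := by
        simp_rw [lintegral_add_left measurable_const, lintegral_const]
        rw [lintegral_add_right _ measurable_const, lintegral_const,
          lintegral_mul_const _ hm, mul_comm (κ univ), mul_comm (μ univ), oscIntegral_comm (μ := ν) hu]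
        rfl

end oscIntegral

/-- The variation on `Ω` controls the mean oscillation between `U` and `V`, with a finite constant
that does not depend on the function. Only measurable functions are considered, which is no loss
since the quantities involved do not change on null sets. -/
def OscBounded {d : ℕ} (Ω U V : Set (EuclideanSpace ℝ (Fin d))) : Prop :=
  ∃ C : ENNReal, C ≠ ⊤ ∧ ∀ u : EuclideanSpace ℝ (Fin d) → ℝ, Measurable u →
    IntegrableOn u Ω volume →
    oscIntegral u (volume.restrict U) (volume.restrict V) ≤ C * bvSeminorm Ω u

section OscBounded

variable {d : ℕ} {Ω U V X : Set (EuclideanSpace ℝ (Fin d))}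

theorem OscBounded.symm (h : OscBounded Ω U V) : OscBounded Ω V U := by
  obtain ⟨C, hC, h⟩ := h
  refine ⟨C, hC, fun u hu hi => ?_⟩
  rw [oscIntegral_comm hu]
  exact h u hu hi

theorem OscBounded.mono {U' V' : Set (EuclideanSpace ℝ (Fin d))} (h : OscBounded Ω U V)
    (hU : U' ⊆ U) (hV : V' ⊆ V) : OscBounded Ω U' V' := by
  obtain ⟨C, hC, h⟩ := h
  exact ⟨C, hC, fun u hu hi => (oscIntegral_mono (Measure.restrict_mono_set _ hU)
    (Measure.restrict_mono_set _ hV)).trans (h u hu hi)⟩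

theorem OscBounded.trans (h₁ : OscBounded Ω U V) (h₂ : OscBounded Ω V X)
    (hU : Bornology.IsBounded U) (hV : Bornology.IsBounded V) (hX : Bornology.IsBounded X)
    (hVo : IsOpen V) (hVne : V.Nonempty) : OscBounded Ω U X := by
  obtain ⟨C₁, hC₁, h₁⟩ := h₁
  obtain ⟨C₂, hC₂, h₂⟩ := h₂
  have hV0 : volume V ≠ 0 := (hVo.measure_pos volume hVne).ne'
  have hUt := hU.measure_lt_top (μ := volume)
  have hVt := hV.measure_lt_top (μ := volume)
  have hXt := hX.measure_lt_top (μ := volume)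
  refine ⟨(volume V)⁻¹ * (volume X * C₁ + volume U * C₂), ?_, fun u hu hi => ?_⟩
  · finiteness
  · refine (oscIntegral_trans (ν := volume.restrict V) hu (by simpa using hV0)
      (by simpa using hVt.ne)).trans ?_
    simp only [Measure.restrict_apply_univ]
    calc _ ≤ (volume V)⁻¹ * (volume X * (C₁ * bvSeminorm Ω u)
            + volume U * (C₂ * bvSeminorm Ω u)) := by
          gcongr
          · exact h₁ u hu hi
          · exact h₂ u hu hi
      _ = _ := by ring

theorem oscBounded_of_segment_subset (hΩ : IsOpen Ω) (hU : IsOpen U) (hUb : Bornology.IsBounded U)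
    (hV : IsOpen V) (hVb : Bornology.IsBounded V)
    (hUV : ∀ x ∈ U, ∀ y ∈ V, segment ℝ x y ⊆ Ω) : OscBounded Ω U V := by
  obtain ⟨D, hD⟩ := Metric.isBounded_iff.1 (hUb.union hVb)
  refine ⟨ENNReal.ofReal (1 * D) * volume (closedBall (0 : EuclideanSpace ℝ (Fin d)) D), ?_,
    fun u hu hi => ?_⟩
  · exact ENNReal.mul_ne_top ENNReal.ofReal_ne_top isBounded_closedBall.measure_lt_top.ne
  · have := lintegral_lintegral_mul_enorm_sub_le (f := fun _ => 1) (M := 1) (D := D) hΩ hi hu hU hUb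
      hV hUV (fun x hx y hy => by
        rw [← dist_eq_norm]; exact hD (Or.inr hy) (Or.inl hx)) measurable_const
      (fun _ _ => zero_le_one) one_pos fun x _ y _ p => by
        calc _ ≤ ∫⁻ s in Ioc (0 : ℝ) 1, 1 :=
              lintegral_mono fun s => indicator_apply_le' (fun _ => by simp) fun _ => zero_le
          _ = _ := by simp
    simpa [oscIntegral] using this

/-- Overlapping convex sets are compared through their intersection. -/
theorem oscBounded_of_convex (hΩ : IsOpen Ω) (hU : IsOpen U) (hUb : Bornology.IsBounded U)
    (hUc : Convex ℝ U) (hUΩ : U ⊆ Ω) (hV : IsOpen V) (hVb : Bornology.IsBounded V)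
    (hVc : Convex ℝ V) (hVΩ : V ⊆ Ω) (hne : (U ∩ V).Nonempty) : OscBounded Ω U V := by
  have h1 : OscBounded Ω U U := oscBounded_of_segment_subset hΩ hU hUb hU hUb
    fun x hx y hy => (hUc.segment_subset hx hy).trans hUΩ
  have h2 : OscBounded Ω V V := oscBounded_of_segment_subset hΩ hV hVb hV hVb
    fun x hx y hy => (hVc.segment_subset hx hy).trans hVΩ
  exact (h1.mono subset_rfl inter_subset_left).trans (h2.mono inter_subset_right subset_rfl) hUb
    (hUb.subset inter_subset_left) hVb (hU.inter hV) hne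

/-- Any two balls in a connected open set are joined by a chain of overlapping balls. -/
theorem oscBounded_ball_ball (hΩ : IsOpen Ω) (hc : IsPreconnected Ω)
    {x y : EuclideanSpace ℝ (Fin d)} {r s : ℝ} (hr : 0 < r) (hs : 0 < s)
    (hx : ball x r ⊆ Ω) (hy : ball y s ⊆ Ω) : OscBounded Ω (ball x r) (ball y s) := by
  have hball : ∀ {x y : EuclideanSpace ℝ (Fin d)} {r s : ℝ}, ball x r ⊆ Ω → ball y s ⊆ Ω →
      (ball x r ∩ ball y s).Nonempty → OscBounded Ω (ball x r) (ball y s) := fun h1 h2 h3 =>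
    oscBounded_of_convex hΩ isOpen_ball isBounded_ball (convex_ball _ _) h1 isOpen_ball
      isBounded_ball (convex_ball _ _) h2 h3
  refine hc.induction₂ (fun x y => ∀ r s : ℝ, 0 < r → 0 < s → ball x r ⊆ Ω → ball y s ⊆ Ω →
    OscBounded Ω (ball x r) (ball y s)) ?_ ?_ ?_ (hx (mem_ball_self hr)) (hy (mem_ball_self hs))
    r s hr hs hx hy
  · intro x hx
    obtain ⟨t, ht, htΩ⟩ := Metric.isOpen_iff.1 hΩ x hx
    filter_upwards [mem_nhdsWithin_of_mem_nhds (ball_mem_nhds x ht)] with y hy r s hr hs hxr hys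
    exact (hball hxr htΩ ⟨x, mem_ball_self hr, mem_ball_self ht⟩).trans
      (hball htΩ hys ⟨y, hy, mem_ball_self hs⟩) isBounded_ball isBounded_ball isBounded_ball
      isOpen_ball ⟨x, mem_ball_self ht⟩
  · intro x y z _ hy _ hxy hyz r s hr hs hxr hzs
    obtain ⟨t, ht, htΩ⟩ := Metric.isOpen_iff.1 hΩ y hy
    exact (hxy r t hr ht hxr htΩ).trans (hyz t s ht hs htΩ hzs) isBounded_ball isBounded_ball
      isBounded_ball isOpen_ball ⟨y, mem_ball_self ht⟩
  · intro x y _ _ h r s hr hs hyr hxs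
    exact (h s r hs hr hxs hyr).symm

end OscBounded

/-! ### The inequality for the individual weights -/

/-- The measure on `Ω` with the `m`-th Hardy weight of the boundary distance as its density. -/
def hardyMeasure (Ω : Set (EuclideanSpace ℝ (Fin (n + 1)))) (R : ℝ) (m : ℕ) :
    Measure (EuclideanSpace ℝ (Fin (n + 1))) :=
  (volume.restrict Ω).withDensity fun x => ENNReal.ofReal (hardyWeight R m (bdryDist Ω x))

instance (R : ℝ) (m : ℕ) : SFinite (hardyMeasure Ω R m) := by
  unfold hardyMeasure; infer_instance

theorem measurable_hardyWeight_bdryDist (R : ℝ) (m : ℕ) :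
    Measurable fun x => hardyWeight R m (bdryDist Ω x) :=
  (measurable_hardyWeight R m).comp measurable_bdryDist

theorem hardyMeasure_restrict {A : Set (EuclideanSpace ℝ (Fin (n + 1)))} (hA : MeasurableSet A)
    (hAΩ : A ⊆ Ω) (R : ℝ) (m : ℕ) :
    (hardyMeasure Ω R m).restrict A = (volume.restrict A).withDensity
      fun x => ENNReal.ofReal (hardyWeight R m (bdryDist Ω x)) := by
  rw [hardyMeasure, restrict_withDensity hA, Measure.restrict_restrict hA,
    inter_eq_self_of_subset_left hAΩ]

/-- Integrating the bound over segments in a fixed direction over all base points. -/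
theorem lintegral_le_of_segment_bound {d : ℕ} {A : Set (EuclideanSpace ℝ (Fin d))}
    {f : EuclideanSpace ℝ (Fin d) → ENNReal} {z : EuclideanSpace ℝ (Fin d)} {M : ENNReal} {r : ℝ}
    (hA : MeasurableSet A) (hAr : A ⊆ closedBall 0 r) (hf : Measurable f)
    (hM : ∀ p, ∫⁻ s in Ioc (0 : ℝ) 1, A.indicator f (p - s • z) ≤ M) :
    ∫⁻ x in A, f x ≤ M * volume (closedBall (0 : EuclideanSpace ℝ (Fin d)) (r + ‖z‖)) := by
  have hfA : Measurable (A.indicator f) := hf.indicator hA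
  have h1 : ∫⁻ x in A, f x = ∫⁻ s in Ioc (0 : ℝ) 1, ∫⁻ p, A.indicator f (p - s • z) := by
    simp_rw [lintegral_sub_right_eq_self (fun p => A.indicator f p), lintegral_indicator hA]
    simp
  have h2 : Measurable fun q : ℝ × EuclideanSpace ℝ (Fin d) => A.indicator f (q.2 - q.1 • z) :=
    hfA.comp (by fun_prop)
  rw [h1, lintegral_lintegral_swap h2.aemeasurable]
  calc _ ≤ ∫⁻ p, (closedBall (0 : EuclideanSpace ℝ (Fin d)) (r + ‖z‖)).indicator (fun _ => M) p := by
        refine lintegral_mono fun p => ?_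
        by_cases hp : p ∈ closedBall (0 : EuclideanSpace ℝ (Fin d)) (r + ‖z‖)
        · rw [indicator_of_mem hp]; exact hM p
        · rw [indicator_of_notMem hp]
          refine le_of_eq (setLIntegral_eq_zero measurableSet_Ioc fun s hs => ?_)
          refine indicator_of_notMem (fun h => hp ?_) _
          have h2 := mem_closedBall_zero_iff.1 (hAr h)
          rw [mem_closedBall_zero_iff]
          calc ‖p‖ = ‖(p - s • z) + s • z‖ := by rw [sub_add_cancel]
            _ ≤ ‖p - s • z‖ + ‖s • z‖ := norm_add_le _ _
            _ ≤ r + ‖z‖ := by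
              refine add_le_add h2 ?_
              rw [norm_smul, Real.norm_of_nonneg hs.1.le]
              exact mul_le_of_le_one_left (norm_nonneg z) hs.2
    _ = _ := by rw [lintegral_indicator isClosed_closedBall.measurableSet, setLIntegral_const]

/-- For a visible pair, the segment bound controls both the weighted measure of `A` and the weighted
oscillation between `A` and `B`. -/
theorem IsVisiblePair.hardyMeasure_le {A B : Set (EuclideanSpace ℝ (Fin (n + 1)))} {C : ℝ}
    (h : IsVisiblePair Ω A B C) (hΩ : IsOpen Ω) (hb : Bornology.IsBounded Ω)
    (hC : 0 < C) (hA : IsOpen A) (hAΩ : A ⊆ Ω) (hAne : A.Nonempty) (hB : IsOpen B) (hBΩ : B ⊆ Ω)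
    (hBne : B.Nonempty) :
    ∃ C' : ENNReal, C' ≠ ⊤ ∧ ∀ R : ℝ, 0 < R → (∀ x ∈ Ω, bdryDist Ω x < R) → ∀ m : ℕ, 1 ≤ m →
      hardyMeasure Ω R m A ≤ C' * 2 ^ m ∧
      ∀ u : EuclideanSpace ℝ (Fin (n + 1)) → ℝ, Measurable u → IntegrableOn u Ω volume →
        oscIntegral u ((hardyMeasure Ω R m).restrict A) (volume.restrict B)
          ≤ C' * 2 ^ m * bvSeminorm Ω u := by
  obtain ⟨D, hD⟩ := Metric.isBounded_iff.1 hb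
  obtain ⟨r, hr⟩ := hb.subset_closedBall 0
  obtain ⟨x₀, hx₀⟩ := hAne
  obtain ⟨y₀, hy₀⟩ := hBne
  have hD0 : 0 ≤ D := dist_nonneg.trans (hD (hAΩ hx₀) (hAΩ hx₀))
  set C₁ := volume (closedBall (0 : EuclideanSpace ℝ (Fin (n + 1))) (r + ‖y₀ - x₀‖)) with hC₁
  set C₂ := volume (closedBall (0 : EuclideanSpace ℝ (Fin (n + 1))) D) with hC₂
  have hC₁t : C₁ ≠ ⊤ := isBounded_closedBall.measure_lt_top.ne
  have hC₂t : C₂ ≠ ⊤ := isBounded_closedBall.measure_lt_top.ne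
  have hpow : ∀ m : ℕ, ENNReal.ofReal (C * 2 ^ m) = ENNReal.ofReal C * 2 ^ m := fun m => by
    rw [ENNReal.ofReal_mul hC.le, ENNReal.ofReal_pow zero_le_two, ENNReal.ofReal_ofNat]
  refine ⟨ENNReal.ofReal C * (C₁ + ENNReal.ofReal D * C₂), by finiteness,
    fun R hR hRΩ m hm => ⟨?_, fun u hu hi => ?_⟩⟩
  · have h1 := lintegral_le_of_segment_bound hA.measurableSet (hAΩ.trans hr)
      (measurable_hardyWeight_bdryDist R m).ennreal_ofReal
      (h.lintegral_le R hR hRΩ m hm x₀ hx₀ y₀ hy₀)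
    rw [← Measure.restrict_apply_univ, hardyMeasure_restrict hA.measurableSet hAΩ,
      withDensity_apply _ MeasurableSet.univ, Measure.restrict_univ]
    refine h1.trans ?_
    rw [hpow, mul_assoc, mul_assoc, mul_comm (2 ^ m : ENNReal)]
    gcongr
    exact le_self_add
  · have h1 := lintegral_lintegral_mul_enorm_sub_le (D := D) hΩ hi hu hA (hb.subset hAΩ) hB
      h.segment_subset (fun x hx y hy => by rw [← dist_eq_norm]; exact hD (hBΩ hy) (hAΩ hx))
      (measurable_hardyWeight_bdryDist R m)
      (fun x hx => hardyWeight_nonneg m (bdryDist_pos hΩ hb (hAΩ hx)) (hRΩ x (hAΩ hx)).le)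
      (by positivity) (h.lintegral_le R hR hRΩ m hm)
    rw [oscIntegral, hardyMeasure_restrict hA.measurableSet hAΩ,
      lintegral_withDensity_eq_lintegral_mul _
        (measurable_hardyWeight_bdryDist R m).ennreal_ofReal (measurable_lintegral_enorm_sub hu)]
    refine le_trans (le_of_eq ?_) (h1.trans ?_)
    · refine lintegral_congr fun x => ?_
      rw [Pi.mul_apply, lintegral_const_mul _ (by fun_prop)]
    · rw [ENNReal.ofReal_mul (by positivity), hpow, ← hC₂]
      calc _ = ENNReal.ofReal C * (ENNReal.ofReal D * C₂) * 2 ^ m * bvSeminorm Ω u := by ring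
        _ ≤ _ := by
          gcongr
          exact le_add_self

/-- The oscillation of `u` between the weighted and the unweighted domain: local estimates near
finitely many points of the closure are joined through a fixed ball. -/
theorem IsBoundedLipschitzDomain.oscIntegral_hardyMeasure_le (hΩ : IsBoundedLipschitzDomain Ω) :
    ∃ C : ENNReal, C ≠ ⊤ ∧ ∀ R : ℝ, 0 < R → (∀ x ∈ Ω, bdryDist Ω x < R) → ∀ m : ℕ, 1 ≤ m →
      ∀ u : EuclideanSpace ℝ (Fin (n + 1)) → ℝ, Measurable u → IntegrableOn u Ω volume →
        oscIntegral u (hardyMeasure Ω R m) (volume.restrict Ω) ≤ C * 2 ^ m * bvSeminorm Ω u := by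
  have hΩo := hΩ.isOpen
  have hΩb := hΩ.isBounded
  obtain ⟨x₀, hx₀⟩ := hΩ.isConnected.nonempty
  obtain ⟨r₀, hr₀, hB₀⟩ := Metric.isOpen_iff.1 hΩo x₀ hx₀
  set B₀ := ball x₀ r₀ with hB₀_def
  -- local estimates, already transferred to the fixed ball
  have hloc : ∀ x ∈ closure Ω, ∃ ρ : ℝ, 0 < ρ ∧ ∃ C : ENNReal, C ≠ ⊤ ∧
      (∀ R : ℝ, 0 < R → (∀ x ∈ Ω, bdryDist Ω x < R) → ∀ m : ℕ, 1 ≤ m →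
        hardyMeasure Ω R m (Ω ∩ ball x ρ) ≤ C * 2 ^ m ∧
        ∀ u : EuclideanSpace ℝ (Fin (n + 1)) → ℝ, Measurable u → IntegrableOn u Ω volume →
          oscIntegral u ((hardyMeasure Ω R m).restrict (Ω ∩ ball x ρ)) (volume.restrict B₀)
            ≤ C * 2 ^ m * bvSeminorm Ω u) ∧
      ∀ u : EuclideanSpace ℝ (Fin (n + 1)) → ℝ, Measurable u → IntegrableOn u Ω volume →
        oscIntegral u (volume.restrict (Ω ∩ ball x ρ)) (volume.restrict B₀)
          ≤ C * bvSeminorm Ω u := by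
    intro x hx
    obtain ⟨ρ, hρ, b, hbΩ, C, hC, hvis⟩ := hΩ.exists_isVisiblePair hx
    have hAo : IsOpen (Ω ∩ ball x ρ) := hΩo.inter isOpen_ball
    have hAne : (Ω ∩ ball x ρ).Nonempty := by
      rw [inter_comm]
      exact mem_closure_iff_nhds.1 hx _ (ball_mem_nhds x hρ)
    have hBne : (ball b ρ).Nonempty := ⟨b, mem_ball_self hρ⟩
    obtain ⟨C₁, hC₁, h₁⟩ := hvis.hardyMeasure_le hΩo hΩb hC hAo inter_subset_left hAne isOpen_ball
      hbΩ hBne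
    have hBB := oscBounded_ball_ball hΩo hΩ.isConnected.isPreconnected hρ hr₀ hbΩ hB₀
    obtain ⟨C₃, hC₃, h₃⟩ := (oscBounded_of_segment_subset hΩo hAo (hΩb.subset inter_subset_left)
      isOpen_ball isBounded_ball hvis.segment_subset).trans hBB (hΩb.subset inter_subset_left)
      isBounded_ball isBounded_ball isOpen_ball hBne
    obtain ⟨C₂, hC₂, h₂⟩ := hBB
    have hb0 : volume (ball b ρ) ≠ 0 := (isOpen_ball.measure_pos volume hBne).ne'
    have hbt : volume (ball b ρ) ≠ ⊤ := isBounded_ball.measure_lt_top.ne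
    have hB₀t : volume B₀ ≠ ⊤ := isBounded_ball.measure_lt_top.ne
    refine ⟨ρ, hρ, C₁ + (volume (ball b ρ))⁻¹ * (volume B₀ * C₁ + C₁ * C₂) + C₃, by finiteness,
      fun R hR hRΩ m hm => ⟨?_, fun u hu hi => ?_⟩, fun u hu hi => ?_⟩
    · refine (h₁ R hR hRΩ m hm).1.trans ?_
      gcongr
      rw [add_assoc]
      exact le_self_add
    · obtain ⟨h4, h5⟩ := h₁ R hR hRΩ m hm
      refine (oscIntegral_trans (ν := volume.restrict (ball b ρ)) hu (by simpa using hb0)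
        (by simpa using hbt)).trans ?_
      simp only [Measure.restrict_apply_univ]
      calc _ ≤ (volume (ball b ρ))⁻¹ * (volume B₀ * (C₁ * 2 ^ m * bvSeminorm Ω u)
              + C₁ * 2 ^ m * (C₂ * bvSeminorm Ω u)) := by
            gcongr
            · exact h5 u hu hi
            · exact h₂ u hu hi
        _ = (volume (ball b ρ))⁻¹ * (volume B₀ * C₁ + C₁ * C₂) * 2 ^ m * bvSeminorm Ω u := by ring
        _ ≤ _ := by
          gcongr
          rw [add_right_comm]
          exact le_add_self
    · refine (h₃ u hu hi).trans ?_
      gcongr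
      exact le_add_self
  choose! ρ hρ C hC hw huw using hloc
  have hcpt : IsCompact (closure Ω) := hΩb.isCompact_closure
  obtain ⟨t, ht, htΩ⟩ := hcpt.elim_nhds_subcover (fun x => ball x (ρ x))
    fun x hx => ball_mem_nhds x (hρ x hx)
  have hcover : Ω ⊆ ⋃ x ∈ t, Ω ∩ ball x (ρ x) := by
    intro y hy
    obtain ⟨x, hx, hyx⟩ := mem_iUnion₂.1 (htΩ (subset_closure hy))
    exact mem_iUnion₂.2 ⟨x, hx, hy, hyx⟩
  set S : ENNReal := ∑ x ∈ t, C x with hS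
  have hSt : S ≠ ⊤ := (ENNReal.sum_lt_top.2 fun x hx => (hC x (ht x hx)).lt_top).ne
  have hsum : ∀ (μ : Measure (EuclideanSpace ℝ (Fin (n + 1)))) (g : _ → ENNReal),
      ∫⁻ x in Ω, g x ∂μ ≤ ∑ x ∈ t, ∫⁻ y in Ω ∩ ball x (ρ x), g y ∂μ := fun μ g =>
    (lintegral_mono_set hcover).trans <| by
      rw [← Finset.sum_coe_sort t (fun x => ∫⁻ y in Ω ∩ ball x (ρ x), g y ∂μ),
        ← tsum_fintype (L := .unconditional _)]
      have := lintegral_iUnion_le (μ := μ) (fun x : t => Ω ∩ ball x.1 (ρ x.1)) g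
      rwa [iUnion_subtype] at this
  have hres : ∀ (R : ℝ) (m : ℕ), (hardyMeasure Ω R m).restrict Ω = hardyMeasure Ω R m := fun R m => by
    rw [hardyMeasure_restrict hΩo.measurableSet subset_rfl]; rfl
  have hB₀0 : volume B₀ ≠ 0 := (isOpen_ball.measure_pos volume ⟨x₀, mem_ball_self hr₀⟩).ne'
  have hB₀t : volume B₀ ≠ ⊤ := isBounded_ball.measure_lt_top.ne
  have hΩt : volume Ω ≠ ⊤ := hΩb.measure_lt_top.ne
  refine ⟨(volume B₀)⁻¹ * (volume Ω * S + S * S), by finiteness, fun R hR hRΩ m hm u hu hi => ?_⟩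
  have h1 : oscIntegral u (hardyMeasure Ω R m) (volume.restrict B₀)
      ≤ S * 2 ^ m * bvSeminorm Ω u := by
    rw [← hres, hS, Finset.sum_mul, Finset.sum_mul]
    exact (hsum _ _).trans (Finset.sum_le_sum fun x hx => (hw x (ht x hx) R hR hRΩ m hm).2 u hu hi)
  have h2 : hardyMeasure Ω R m univ ≤ S * 2 ^ m := by
    rw [← hres, hS, Finset.sum_mul, Measure.restrict_apply_univ]
    refine (measure_mono hcover).trans ((measure_biUnion_finset_le _ _).trans ?_)
    exact Finset.sum_le_sum fun x hx => (hw x (ht x hx) R hR hRΩ m hm).1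
  have h3 : oscIntegral u (volume.restrict B₀) (volume.restrict Ω) ≤ S * bvSeminorm Ω u := by
    rw [oscIntegral_comm hu, hS, Finset.sum_mul]
    exact (hsum _ _).trans (Finset.sum_le_sum fun x hx => huw x (ht x hx) u hu hi)
  refine (oscIntegral_trans (ν := volume.restrict B₀) hu (by simpa using hB₀0)
    (by simpa using hB₀t)).trans ?_
  simp only [Measure.restrict_apply_univ]
  calc _ ≤ (volume B₀)⁻¹ * (volume Ω * (S * 2 ^ m * bvSeminorm Ω u)
          + S * 2 ^ m * (S * bvSeminorm Ω u)) := by gcongr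
    _ = _ := by ring

/-- In `Ω` the weight is nonnegative, so it separates from `|u - (u)_Ω|` in `[0, ∞]`. -/
theorem hardyIntegral_eq_lintegral (hΩ : IsOpen Ω) (hb : Bornology.IsBounded Ω) {R : ℝ}
    (hRΩ : ∀ x ∈ Ω, bdryDist Ω x < R) (m : ℕ) (u : EuclideanSpace ℝ (Fin (n + 1)) → ℝ) :
    hardyIntegral Ω R m u = ∫⁻ x in Ω,
      ENNReal.ofReal (hardyWeight R m (bdryDist Ω x)) * ‖u x - ⨍ y in Ω, u y‖ₑ := by
  refine setLIntegral_congr_fun hΩ.measurableSet fun x hx => ?_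
  have h0 := hardyWeight_nonneg m (bdryDist_pos hΩ hb hx) (hRΩ x hx).le
  simp only [Real.enorm_eq_ofReal_abs]
  rw [← ENNReal.ofReal_mul h0, hardyWeight, div_eq_mul_inv]
  ring_nf

theorem enorm_sub_average_le {α : Type*} [MeasurableSpace α] {μ : Measure α} [IsFiniteMeasure μ]
    [NeZero μ] {u : α → ℝ} (hu : Integrable u μ) (c : ℝ) :
    ‖c - ⨍ y, u y ∂μ‖ₑ ≤ (μ univ)⁻¹ * ∫⁻ y, ‖c - u y‖ₑ ∂μ := by
  have h1 : c - ⨍ y, u y ∂μ = ⨍ y, (c - u y) ∂μ := by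
    rw [average_eq, average_eq, integral_sub (integrable_const c) hu, smul_sub, integral_const,
      smul_smul, inv_mul_cancel₀ (measureReal_univ_pos).ne', one_smul]
  rw [h1, average, ← smul_eq_mul, ← lintegral_smul_measure]
  exact enorm_integral_le_lintegral_enorm _

theorem hardyIntegral_congr_ae {u v : EuclideanSpace ℝ (Fin (n + 1)) → ℝ} {R : ℝ} {m : ℕ}
    (h : u =ᵐ[volume.restrict Ω] v) : hardyIntegral Ω R m u = hardyIntegral Ω R m v := by
  unfold hardyIntegral
  rw [average_congr h]
  refine lintegral_congr_ae ?_
  filter_upwards [h] with x hx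
  rw [hx]

theorem bvSeminorm_congr_ae {d : ℕ} {Ω : Set (EuclideanSpace ℝ (Fin d))}
    {u v : EuclideanSpace ℝ (Fin d) → ℝ} (h : u =ᵐ[volume.restrict Ω] v) :
    bvSeminorm Ω u = bvSeminorm Ω v := by
  unfold bvSeminorm
  congr! 4 with φ hφ
  refine integral_congr_ae ?_
  filter_upwards [h] with x hx
  rw [hx]

theorem IsBoundedLipschitzDomain.hardyIntegral_le (hΩ : IsBoundedLipschitzDomain Ω) :
    ∃ C : ℝ, 0 < C ∧ ∀ R : ℝ, 0 < R → (∀ x ∈ Ω, bdryDist Ω x < R) → ∀ m : ℕ, 2 ≤ m →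
      ∀ u : EuclideanSpace ℝ (Fin (n + 1)) → ℝ, MemBV Ω u →
        hardyIntegral Ω R m u ≤ ENNReal.ofReal (C * 2 ^ m) * bvSeminorm Ω u := by
  obtain ⟨C, hC, h⟩ := hΩ.oscIntegral_hardyMeasure_le
  have hΩ0 : volume Ω ≠ 0 := (hΩ.isOpen.measure_pos volume hΩ.isConnected.nonempty).ne'
  have hΩt : volume Ω ≠ ⊤ := hΩ.isBounded.measure_lt_top.ne
  set C' : ENNReal := (volume Ω)⁻¹ * C with hC'
  have hC't : C' ≠ ⊤ := by finiteness
  refine ⟨C'.toReal + 1, by positivity, fun R hR hRΩ m hm u ⟨hi, _⟩ => ?_⟩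
  obtain ⟨v, hv, huv⟩ := hi.aestronglyMeasurable.aemeasurable
  have hvi : IntegrableOn v Ω volume := hi.congr huv
  rw [hardyIntegral_congr_ae huv, bvSeminorm_congr_ae huv,
    hardyIntegral_eq_lintegral hΩ.isOpen hΩ.isBounded hRΩ]
  have : IsFiniteMeasure (volume.restrict Ω) := ⟨by simpa using hΩ.isBounded.measure_lt_top⟩
  have : NeZero (volume.restrict Ω) := ⟨by simpa using hΩ0⟩
  have hw := (measurable_hardyWeight_bdryDist (Ω := Ω) R m).ennreal_ofReal
  calc _ ≤ ∫⁻ x in Ω, ENNReal.ofReal (hardyWeight R m (bdryDist Ω x))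
          * ((volume Ω)⁻¹ * ∫⁻ y in Ω, ‖v x - v y‖ₑ) := by
        refine lintegral_mono fun x => ?_
        have := enorm_sub_average_le hvi (v x)
        rw [Measure.restrict_apply_univ] at this
        gcongr
    _ = (volume Ω)⁻¹ * oscIntegral v (hardyMeasure Ω R m) (volume.restrict Ω) := by
        rw [oscIntegral, hardyMeasure, lintegral_withDensity_eq_lintegral_mul _ hw
          (measurable_lintegral_enorm_sub hv), ← lintegral_const_mul _
          (hw.mul (measurable_lintegral_enorm_sub hv))]
        refine lintegral_congr fun x => ?_
        rw [Pi.mul_apply]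
        ring
    _ ≤ (volume Ω)⁻¹ * (C * 2 ^ m * bvSeminorm Ω v) := by
        gcongr
        exact h R hR hRΩ m (by omega) v hv hvi
    _ = C' * 2 ^ m * bvSeminorm Ω v := by rw [hC']; ring
    _ ≤ _ := by
        rw [ENNReal.ofReal_mul (by positivity), ENNReal.ofReal_pow zero_le_two,
          ENNReal.ofReal_ofNat]
        gcongr
        rw [← ENNReal.ofReal_toReal hC't]
        exact ENNReal.ofReal_le_ofReal (by simp)

theorem IsBoundedLipschitzDomain.hardySeries_le (hΩ : IsBoundedLipschitzDomain Ω) :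
    ∃ C : ℝ, 0 < C ∧ ∀ R : ℝ, 0 < R → (∀ x ∈ Ω, bdryDist Ω x < R) →
      ∀ α : ℝ, 0 < α → α < 1 / 2 → ∀ u : EuclideanSpace ℝ (Fin (n + 1)) → ℝ, MemBV Ω u →
        hardySeries Ω R α u
          ≤ ENNReal.ofReal (C * (4 * α ^ 2 / (1 - 2 * α))) * bvSeminorm Ω u := by
  obtain ⟨C, hC, h⟩ := hΩ.hardyIntegral_le
  refine ⟨C, hC, fun R hR hRΩ α hα hα2 u hu => ?_⟩
  have hgeo : HasSum (fun j : ℕ => C * (4 * α ^ 2) * (2 * α) ^ j)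
      (C * (4 * α ^ 2) * (1 - 2 * α)⁻¹) :=
    (hasSum_geometric_of_lt_one (by positivity) (by linarith)).mul_left _
  calc hardySeries Ω R α u
      ≤ ∑' j : ℕ, ENNReal.ofReal (C * (4 * α ^ 2) * (2 * α) ^ j) * bvSeminorm Ω u := by
        refine ENNReal.tsum_le_tsum fun j => ?_
        calc _ ≤ ENNReal.ofReal (α ^ (j + 2))
              * (ENNReal.ofReal (C * 2 ^ (j + 2)) * bvSeminorm Ω u) := by
              gcongr
              exact h R hR hRΩ (j + 2) (by omega) u hu
          _ = _ := by
              rw [← mul_assoc, ← ENNReal.ofReal_mul (by positivity)]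
              congr 2
              ring
    _ = _ := by
        rw [ENNReal.tsum_mul_right, ← ENNReal.ofReal_tsum_of_nonneg (fun j => by positivity)
          hgeo.summable, hgeo.tsum_eq]
        congr 2
        ring

/-! ### Failure of the series inequality -/

/-- Integration by parts bounds the variation of a compactly supported `C¹` function by the
integrals of its partial derivatives. -/
theorem integral_mul_divergence_le {d : ℕ} {u : EuclideanSpace ℝ (Fin d) → ℝ}
    {φ : EuclideanSpace ℝ (Fin d) → EuclideanSpace ℝ (Fin d)} (hu : ContDiff ℝ 1 u)
    (huc : HasCompactSupport u) (hφ : ContDiff ℝ 1 φ) (hφ1 : ∀ x, ‖φ x‖ ≤ 1) :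
    ∫ x, u x * divergence φ x
      ≤ ∑ i : Fin d, ∫ x, |fderiv ℝ u x (EuclideanSpace.single i (1 : ℝ))| := by
  have hφi : ∀ i, ContDiff ℝ 1 fun x => φ x i := fun i => by fun_prop
  have hder : ∀ x i, (fderiv ℝ φ x (EuclideanSpace.single i (1 : ℝ))) i
      = fderiv ℝ (fun x => φ x i) x (EuclideanSpace.single i (1 : ℝ)) := by
    intro x i
    have h1 := (hφ.differentiable one_ne_zero x).hasFDerivAt
    have h2 := (EuclideanSpace.proj (𝕜 := ℝ) i).hasFDerivAt.comp x h1
    have h3 : fderiv ℝ (fun x => φ x i) x = (EuclideanSpace.proj (𝕜 := ℝ) i).comp (fderiv ℝ φ x) :=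
      h2.fderiv
    rw [h3]
    rfl
  have hu' : ∀ i : Fin d, Continuous fun x => fderiv ℝ u x (EuclideanSpace.single i (1 : ℝ)) :=
    fun i => (hu.continuous_fderiv one_ne_zero).clm_apply continuous_const
  have hφ' : ∀ i : Fin d, Continuous fun x =>
      fderiv ℝ (fun x => φ x i) x (EuclideanSpace.single i (1 : ℝ)) :=
    fun i => ((hφi i).continuous_fderiv one_ne_zero).clm_apply continuous_const
  have hu'c : ∀ i : Fin d, HasCompactSupport fun x =>
      fderiv ℝ u x (EuclideanSpace.single i (1 : ℝ)) := fun i => huc.fderiv_apply ℝ _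
  have hint : ∀ i : Fin d, Integrable (fun x =>
      u x * fderiv ℝ (fun x => φ x i) x (EuclideanSpace.single i (1 : ℝ))) volume := fun i =>
    (hu.continuous.mul (hφ' i)).integrable_of_hasCompactSupport huc.mul_right
  have hint' : ∀ i : Fin d, Integrable (fun x =>
      fderiv ℝ u x (EuclideanSpace.single i (1 : ℝ)) * φ x i) volume := fun i =>
    ((hu' i).mul (hφi i).continuous).integrable_of_hasCompactSupport (hu'c i).mul_right
  simp only [divergence, hder, Finset.mul_sum]
  rw [integral_finsetSum _ fun i _ => hint i]
  refine Finset.sum_le_sum fun i _ => ?_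
  rw [integral_mul_fderiv_eq_neg_fderiv_mul_of_integrable (hint' i) (hint i)
    ((hu.continuous.mul (hφi i).continuous).integrable_of_hasCompactSupport huc.mul_right)
    (fun x _ => hu.differentiable one_ne_zero x)
    (fun x _ => (hφi i).differentiable one_ne_zero x), ← integral_neg]
  refine integral_mono (hint' i).neg
    ((hu' i).abs.integrable_of_hasCompactSupport (hu'c i).abs) fun x => ?_
  have h1 : |φ x i| ≤ 1 := (PiLp.norm_apply_le (φ x) i).trans (hφ1 x)
  calc -(fderiv ℝ u x (EuclideanSpace.single i (1 : ℝ)) * φ x i)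
      ≤ |fderiv ℝ u x (EuclideanSpace.single i (1 : ℝ)) * φ x i| := neg_le_abs _
    _ ≤ _ := by
      rw [abs_mul]
      exact mul_le_of_le_one_right (abs_nonneg _) h1

theorem memBV_of_contDiff {d : ℕ} {Ω : Set (EuclideanSpace ℝ (Fin d))}
    {u : EuclideanSpace ℝ (Fin d) → ℝ} (hu : ContDiff ℝ 1 u) (huc : HasCompactSupport u)
    (huΩ : tsupport u ⊆ Ω) : MemBV Ω u := by
  refine ⟨(hu.continuous.integrable_of_hasCompactSupport huc).integrableOn, ?_⟩
  refine lt_of_le_of_lt (iSup₂_le fun φ hφ => ENNReal.ofReal_le_ofReal ?_)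
    (ENNReal.ofReal_lt_top (r := ∑ i : Fin d,
      ∫ x, |fderiv ℝ u x (EuclideanSpace.single i (1 : ℝ))|))
  rw [setIntegral_eq_integral_of_forall_compl_eq_zero fun x hx => by
    rw [image_eq_zero_of_notMem_tsupport fun h => hx (huΩ h), zero_mul]]
  exact integral_mul_divergence_le hu huc hφ.1 hφ.2.2.2

/-- The weights have a uniform lower bound along each ray: up to the first exit from `Ω`, the
boundary distance takes all values between its initial value and `0`, with unit speed at most. -/
theorem ofReal_le_lintegral_ray (hΩ : IsOpen Ω) (hb : Bornology.IsBounded Ω) {R L : ℝ}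
    (hRΩ : ∀ x ∈ Ω, bdryDist Ω x < R) {m : ℕ} (hm : 1 ≤ m)
    {x e : EuclideanSpace ℝ (Fin (n + 1))} (hx : x ∈ Ω) (he : ‖e‖ = 1) (hL : 0 < L)
    (hxL : x + L • e ∉ Ω) :
    ENNReal.ofReal (bdryDist Ω x / R) ≤ ∫⁻ s in Ioc 0 L,
      Ω.indicator (fun y => ENNReal.ofReal (hardyWeight R m (bdryDist Ω y))) (x + s • e) := by
  have hcont : Continuous fun s : ℝ => x + s • e := by fun_prop
  have hcpt : IsCompact (Icc 0 L ∩ (fun s : ℝ => x + s • e) ⁻¹' Ωᶜ) :=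
    isCompact_Icc.inter_right (hΩ.isClosed_compl.preimage hcont)
  obtain ⟨b, ⟨hbI, hbΩ⟩, hbmin⟩ := hcpt.exists_isLeast ⟨L, ⟨hL.le, le_rfl⟩, hxL⟩
  have hbin : ∀ s ∈ Ico 0 b, x + s • e ∈ Ω := by
    intro s hs
    by_contra h
    exact absurd (hbmin ⟨⟨hs.1, hs.2.le.trans hbI.2⟩, h⟩) (not_le.2 hs.2)
  have hdist : ∀ s s' : ℝ, dist (x + s • e) (x + s' • e) = |s - s'| := by
    intro s s'
    rw [dist_add_left, dist_eq_norm, ← sub_smul, norm_smul, he, mul_one, Real.norm_eq_abs]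
  set q : ℝ → ℝ := fun s => bdryDist Ω (x + s • e) with hq_def
  have hq : LipschitzWith 1 q := by
    refine LipschitzWith.of_dist_le_mul fun s s' => ?_
    rw [Real.dist_eq s, ← hdist]
    exact lipschitzWith_bdryDist.dist_le_mul _ _
  have hb0 : 0 < b := by
    refine lt_of_le_of_ne hbI.1 fun h => hbΩ ?_
    rw [← h]
    simpa using hx
  -- `b` is the first exit time, so the boundary distance vanishes there
  have hqb : q b = 0 := by
    have hlim : Tendsto q (𝓝[<] b) (𝓝 (q b)) :=
      hq.continuous.continuousAt.tendsto.mono_left nhdsWithin_le_nhds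
    have hlim' : Tendsto (fun s => b - s) (𝓝[<] b) (𝓝 0) := by
      have : Tendsto (fun s => b - s) (𝓝 b) (𝓝 (b - b)) := tendsto_const_nhds.sub tendsto_id
      rw [sub_self] at this
      exact this.mono_left nhdsWithin_le_nhds
    refine le_antisymm (le_of_tendsto_of_tendsto hlim hlim' ?_) infDist_nonneg
    filter_upwards [Ioo_mem_nhdsLT hb0] with s hs
    refine (bdryDist_le_dist (hbin s ⟨hs.1.le, hs.2⟩) hbΩ).trans (le_of_eq ?_)
    rw [hdist, abs_sub_comm, abs_of_pos (sub_pos.2 hs.2)]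
  have hδ0 := bdryDist_pos hΩ hb hx
  have hδR := hRΩ x hx
  have hR : 0 < R := hδ0.trans hδR
  have hq0 : q 0 = bdryDist Ω x := by simp [hq_def]
  calc ENNReal.ofReal (bdryDist Ω x / R)
      ≤ ENNReal.ofReal (iterL m (bdryDist Ω x / R)) :=
        ENNReal.ofReal_le_ofReal (le_iterL m (by positivity) ((div_le_one hR).2 hδR.le))
    _ = ∫⁻ t in Ioo 0 (bdryDist Ω x), ENNReal.ofReal (hardyWeight R m t) :=
        (lintegral_hardyWeight hm hδ0 hδR.le).symm
    _ ≤ ∫⁻ s in Ioo 0 b, ENNReal.ofReal (hardyWeight R m (q s)) :=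
        lintegral_Ioo_le_of_nonexpansive hb0.le hq hq0 hqb
          (measurable_hardyWeight R m).ennreal_ofReal
    _ = ∫⁻ s in Ioo 0 b, Ω.indicator
          (fun y => ENNReal.ofReal (hardyWeight R m (bdryDist Ω y))) (x + s • e) :=
        setLIntegral_congr_fun measurableSet_Ioo fun s hs => by
          rw [indicator_of_mem (hbin s ⟨hs.1.le, hs.2⟩)]
    _ ≤ _ := lintegral_mono_set (Ioo_subset_Ioc_self.trans (Ioc_subset_Ioc_right hbI.2))

/-- A single bump function whose Hardy integrals are bounded below uniformly in `m`. -/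
theorem exists_memBV_le_hardyIntegral (hΩ : IsOpen Ω) (hb : Bornology.IsBounded Ω)
    (hne : Ω.Nonempty) {R : ℝ} (hR : 0 < R) (hRΩ : ∀ x ∈ Ω, bdryDist Ω x < R) :
    ∃ u : EuclideanSpace ℝ (Fin (n + 1)) → ℝ, MemBV Ω u ∧ ∃ c : ENNReal, c ≠ 0 ∧
      ∀ m : ℕ, 1 ≤ m → c ≤ hardyIntegral Ω R m u := by
  obtain ⟨p, hp⟩ := hne
  obtain ⟨r, hr, hrΩ⟩ := Metric.isOpen_iff.1 hΩ p hp
  set ρ : ℝ := r / 6 with hρ_def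
  have hρ : 0 < ρ := by positivity
  have hrρ : r = 6 * ρ := by rw [hρ_def]; ring
  set e : EuclideanSpace ℝ (Fin (n + 1)) := EuclideanSpace.single 0 1 with he_def
  have he : ‖e‖ = 1 := by simp [he_def]
  set q := p + (4 * ρ) • e with hq_def
  let u : ContDiffBump p := ⟨ρ, 2 * ρ, hρ, by linarith⟩
  have huΩ : tsupport u ⊆ Ω := by
    rw [u.tsupport_eq]
    exact (closedBall_subset_ball (by change 2 * ρ < r; linarith)).trans hrΩ
  have huBV : MemBV Ω u := memBV_of_contDiff u.contDiff u.hasCompactSupport huΩ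
  obtain ⟨D, hD⟩ := Metric.isBounded_iff.1 hb
  have hD0 : 0 ≤ D := dist_nonneg.trans (hD hp hp)
  set L := D + 1 with hL_def
  have hL : 0 < L := by positivity
  have hqΩ : ∀ x ∈ ball q ρ, ball x ρ ⊆ Ω := by
    intro x hx
    refine (ball_subset_ball' ?_).trans hrΩ
    have h1 : dist q p = 4 * ρ := by
      rw [dist_eq_norm, hq_def, add_sub_cancel_left, norm_smul, he, mul_one,
        Real.norm_of_nonneg (by positivity)]
    have h2 := dist_triangle x q p
    have h3 := mem_ball.1 hx
    linarith
  -- rays in direction `e` that start in `ball q ρ` do not meet the support of `u`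
  have hray : ∀ x ∈ ball q ρ, ∀ s : ℝ, 0 ≤ s → x + s • e ∉ ball p (2 * ρ) := by
    intro x hx s hs h
    rw [mem_ball, dist_eq_norm] at hx h
    have h1 := (abs_le.1 ((PiLp.norm_apply_le (x - q) 0).trans hx.le)).1
    have h2 := (abs_le.1 ((PiLp.norm_apply_le (x + s • e - p) 0).trans h.le)).2
    simp [hq_def, he_def] at h1 h2
    linarith
  -- on `S` the function `u` vanishes and `|u - (u)_Ω|` is the constant `a`
  set S := Ω \ ball p (2 * ρ) with hS_def
  have hSm : MeasurableSet S := hΩ.measurableSet.diff isOpen_ball.measurableSet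
  set a := ⨍ y in Ω, u y with ha_def
  have ha : 0 < a := by
    have hvol : 0 < (volume.restrict Ω).real univ := by
      rw [measureReal_restrict_apply_univ]
      exact ENNReal.toReal_pos (hΩ.measure_pos volume ⟨p, hp⟩).ne' hb.measure_lt_top.ne
    rw [ha_def, average_eq, smul_eq_mul,
      setIntegral_eq_integral_of_forall_compl_eq_zero fun x hx =>
        image_eq_zero_of_notMem_tsupport fun h => hx (huΩ h)]
    exact mul_pos (inv_pos.2 hvol) u.integral_pos
  set c := ENNReal.ofReal (ρ / R) * volume (ball q ρ) / ENNReal.ofReal L * ENNReal.ofReal a with hc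
  have hvol : volume (ball q ρ) ≠ 0 := (measure_ball_pos volume q hρ).ne'
  refine ⟨u, huBV, c, ?_, fun m hm => ?_⟩
  · have h1 : ENNReal.ofReal (ρ / R) ≠ 0 := by simpa using div_pos hρ hR
    have h2 : ENNReal.ofReal a ≠ 0 := by simpa using ha
    exact mul_ne_zero (ENNReal.div_ne_zero.2 ⟨mul_ne_zero h1 hvol, ENNReal.ofReal_ne_top⟩) h2
  set w : EuclideanSpace ℝ (Fin (n + 1)) → ENNReal :=
    fun y => ENNReal.ofReal (hardyWeight R m (bdryDist Ω y)) with hw_def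
  have hwm : Measurable w := (measurable_hardyWeight_bdryDist R m).ennreal_ofReal
  have hline : ∀ x ∈ ball q ρ,
      ENNReal.ofReal (ρ / R) ≤ ∫⁻ s in Ioc 0 L, S.indicator w (x + s • e) := by
    intro x hx
    have hxΩ : x ∈ Ω := hqΩ x hx (mem_ball_self hρ)
    have hδ : ρ ≤ bdryDist Ω x := by
      refine (le_infDist (frontier_nonempty_of_isBounded ⟨p, hp⟩ hb)).2 fun y hy => ?_
      rw [hΩ.frontier_eq] at hy
      rw [dist_comm]
      exact not_lt.1 fun h => hy.2 (hqΩ x hx h)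
    have hxL : x + L • e ∉ Ω := by
      intro h
      have := hD h hxΩ
      rw [dist_eq_norm, add_sub_cancel_left, norm_smul, he, mul_one, Real.norm_of_nonneg hL.le]
        at this
      linarith
    calc ENNReal.ofReal (ρ / R) ≤ ENNReal.ofReal (bdryDist Ω x / R) := by gcongr
      _ ≤ ∫⁻ s in Ioc 0 L, Ω.indicator w (x + s • e) :=
        ofReal_le_lintegral_ray hΩ hb hRΩ hm hxΩ he hL hxL
      _ = _ := by
        refine setLIntegral_congr_fun measurableSet_Ioc fun s hs => ?_
        by_cases h : x + s • e ∈ Ω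
        · rw [indicator_of_mem h, indicator_of_mem (show x + s • e ∈ S from ⟨h, hray x hx s hs.1.le⟩)]
        · rw [indicator_of_notMem h, indicator_of_notMem fun h' => h h'.1]
  have hmeas : Measurable fun z : EuclideanSpace ℝ (Fin (n + 1)) × ℝ =>
      S.indicator w (z.1 + z.2 • e) := (hwm.indicator hSm).comp (by fun_prop)
  have hint : ENNReal.ofReal (ρ / R) * volume (ball q ρ) ≤ (∫⁻ y in S, w y) * ENNReal.ofReal L := by
    calc _ = ∫⁻ _ in ball q ρ, ENNReal.ofReal (ρ / R) := by rw [setLIntegral_const]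
      _ ≤ ∫⁻ x in ball q ρ, ∫⁻ s in Ioc 0 L, S.indicator w (x + s • e) :=
        setLIntegral_mono' measurableSet_ball hline
      _ ≤ ∫⁻ x, ∫⁻ s in Ioc 0 L, S.indicator w (x + s • e) := setLIntegral_le_lintegral _ _
      _ = ∫⁻ s in Ioc 0 L, ∫⁻ x, S.indicator w (x + s • e) :=
        lintegral_lintegral_swap hmeas.aemeasurable
      _ = _ := by
        simp_rw [lintegral_add_right_eq_self (fun x => S.indicator w x), lintegral_indicator hSm,
          setLIntegral_const, Real.volume_Ioc, sub_zero]
  have hSint : ENNReal.ofReal (ρ / R) * volume (ball q ρ) / ENNReal.ofReal L ≤ ∫⁻ y in S, w y :=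
    ENNReal.div_le_of_le_mul hint
  rw [hardyIntegral_eq_lintegral hΩ hb hRΩ]
  calc c ≤ (∫⁻ y in S, w y) * ENNReal.ofReal a := by rw [hc]; gcongr
    _ = ∫⁻ y in S, w y * ‖u y - a‖ₑ := by
      rw [← lintegral_mul_const _ hwm]
      refine setLIntegral_congr_fun hSm fun y hy => ?_
      have huy : u y = 0 := by
        by_contra h
        have : y ∈ Function.support u := h
        rw [u.support_eq] at this
        exact hy.2 this
      simp only [huy, zero_sub, enorm_neg, Real.enorm_eq_ofReal ha.le]
    _ ≤ _ := lintegral_mono_set sdiff_subset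

theorem not_exists_hardySeries_le (hΩ : IsOpen Ω) (hb : Bornology.IsBounded Ω)
    (hne : Ω.Nonempty) {R α : ℝ} (hR : 0 < R) (hRΩ : ∀ x ∈ Ω, bdryDist Ω x < R) (hα : 1 ≤ α) :
    ¬ ∃ K : NNReal, ∀ u : EuclideanSpace ℝ (Fin (n + 1)) → ℝ, MemBV Ω u →
      hardySeries Ω R α u ≤ (K : ENNReal) * bvSeminorm Ω u := by
  rintro ⟨K, hK⟩
  obtain ⟨u, hu, c, hc, hcm⟩ := exists_memBV_le_hardyIntegral hΩ hb hne hR hRΩ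
  have htop : hardySeries Ω R α u = ⊤ := by
    rw [eq_top_iff, ← ENNReal.tsum_const_eq_top_of_ne_zero (α := ℕ) hc]
    refine ENNReal.tsum_le_tsum fun j => (hcm (j + 2) (by omega)).trans ?_
    refine le_mul_of_one_le_left' ?_
    rw [← ENNReal.ofReal_one]
    exact ENNReal.ofReal_le_ofReal (one_le_pow₀ hα)
  have h := hK u hu
  rw [htop] at h
  exact absurd h (not_le.2 (ENNReal.mul_lt_top ENNReal.coe_lt_top hu.2))

end BVHardy

end

theorem theorem1p1 (n : ℕ) (Ω : Set (EuclideanSpace ℝ (Fin (n + 1))))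
    (hΩ : BVHardy.IsBoundedLipschitzDomain Ω) :
    -- the inequality for each `m ≥ 2`, with a constant depending only on `d = n + 1` and `Ω`
    (∃ C : ℝ, 0 < C ∧
      ∀ R : ℝ, 0 < R → (∀ x ∈ Ω, BVHardy.bdryDist Ω x < R) →
      ∀ m : ℕ, 2 ≤ m →
      ∀ u : EuclideanSpace ℝ (Fin (n + 1)) → ℝ, BVHardy.MemBV Ω u →
        BVHardy.hardyIntegral Ω R m u
          ≤ ENNReal.ofReal (C * 2 ^ m) * BVHardy.bvSeminorm Ω u) ∧
    -- the series inequality for `0 < α < 1 / 2`, again with a constant depending only on `d`, `Ω`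
    (∃ C : ℝ, 0 < C ∧
      ∀ R : ℝ, 0 < R → (∀ x ∈ Ω, BVHardy.bdryDist Ω x < R) →
      ∀ α : ℝ, 0 < α → α < 1 / 2 →
      ∀ u : EuclideanSpace ℝ (Fin (n + 1)) → ℝ, BVHardy.MemBV Ω u →
        BVHardy.hardySeries Ω R α u
          ≤ ENNReal.ofReal (C * (4 * α ^ 2 / (1 - 2 * α))) * BVHardy.bvSeminorm Ω u) ∧
    -- for `α ≥ 1` no finite constant whatsoever is possible
    (∀ R : ℝ, 0 < R → (∀ x ∈ Ω, BVHardy.bdryDist Ω x < R) →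
      ∀ α : ℝ, 1 ≤ α →
      ¬ ∃ K : NNReal, ∀ u : EuclideanSpace ℝ (Fin (n + 1)) → ℝ, BVHardy.MemBV Ω u →
        BVHardy.hardySeries Ω R α u ≤ (K : ENNReal) * BVHardy.bvSeminorm Ω u) :=
  ⟨hΩ.hardyIntegral_le, hΩ.hardySeries_le, fun _ hR hRΩ _ hα =>
    BVHardy.not_exists_hardySeries_le hΩ.isOpen hΩ.isBounded hΩ.isConnected.nonempty hR hRΩ hα⟩
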